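/- **Theorem.** Let $0<\theta<1$ and let $K\ge 0$ be an integer (the buffer size). Consider the following discrete-time single-server queue. Time is divided into blocks. Packets are served one at a time; the service times of the packets, in complete blocks, are i.i.d. with the Poisson law $\Pr\{T=k\}=e^{-\theta}\theta^k/k!$, $k\ge 0$. A service begins at the start of a block; a packet with $T=k\ge 1$ occupies the server for $k$ blocks, and a packet with $T=0$ leaves at the very block start at which its service would begin, after which the next packet (if any) begins its service at the same block start. One packet arrives at the end of every block; if the packet in service completes its last block, it has left before the admission of the arriving packet is decided, and the arriving packet is lost if and only if it then finds $K$ packets in the buffer. (Thus the numbers of packets left behind at successive departures satisfy $\widehat L_{n+1}=\min\{\max(\widehat L_n,1)-1+T_{n+1},\,K\}$ for $K \ge 1$.) Let $Q_n$ be the number of packets present at the start of block $n$, after the departures at that instant, and let $R_n$ be the number of complete blocks still needed by the packet in service ($R_n=0$ if $Q_n=0$). Put $\varphi_{-1}=1$ and $$\varphi_k=(1-\theta)\sum_{j=1}^{\infty}\frac{(j\theta)^{k+j}}{(k+j)!}\,e^{-j\theta},\qquad k\ge 0 .$$ Then these series converge, the Markov chain $(Q_n,R_n)$ has exactly one stationary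 distribution, and its queue-length marginal $(\pi_j^K)_{0\le j\le K}$, which is also the limit $\pi^K_j=\lim_{n\to\infty}\Pr\{Q_n=j\}$ from every initial state, is $$\pi_j^K=\frac{\varphi_{j-1}-\varphi_j}{1-\theta\varphi_K}\quad(0\le j\le K-1),\qquad \pi_K^K=\frac{\varphi_{K-1}-\theta\varphi_K}{1-\theta\varphi_K}.$$ -/

import Mathlib

open Filter Topology MeasureTheory ProbabilityTheory
open scoped NNReal ENNReal Nat

noncomputable section

namespace FadingQueue

/-- The law of the service time `T` of a packet, the number of complete blocks it uses:
`Pr{T = k} = exp (-θ) θ ^ k / k!`. -/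
def serviceTime (θ : ℝ≥0) : PMF ℕ := (poissonMeasure θ).toPMF

/-- State of the queue at the start of a block: `(q, r)` with `q` the number of packets present and
`r` the number of complete blocks that the packet in service still needs. -/
abbrev State := ℕ × ℕ

/-- The state at the start of a block at which `q` packets are present and none of them has begun
its service. The first packet draws a fresh service time `T`; if `T = 0` it leaves at once (at this
same block start) and the next packet begins its service. -/
def startService (θ : ℝ≥0) : ℕ → PMF State
  | 0 => PMF.pure (0, 0)
  | q + 1 => (serviceTime θ).bind fun k =>
      if k = 0 then startService θ q else PMF.pure (q + 1, k)

/-- One block of the finite-buffer queue with buffer size `K`. One packet arrives at the end of the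
block and is lost if it finds `K` packets; a packet whose service ends with this block has left
before the admission is decided, and then the next service begins.

* Empty queue: the arriving packet begins its service at the next block start.
* `r ≥ 2`: the service goes on, with one block less.
* `r = 1`: the packet in service leaves, which makes room for the arriving packet, so the queue
  length is unchanged, and the next packet begins its service.

Hence a departure that leaves `i` packets is followed by a departure that leaves
`min (max i 1 - 1 + T) K`, i.e. the queue length at successive departures is the Markov chain on
`{0, …, K}` with rows `0` and `1` equal to `(p₀, …, p_{K-1}, Pr{T ≥ K})` and row `i ≥ 1` equal to
`(0, …, 0, p₀, p₁, …, p_{K-i}, Pr{T ≥ K + 1 - i})`, with `i - 1` leading zeros.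
The pairs with `q > K`, or with exactly one zero entry, are not states of the system; the chain
leaves them for good, and they are given a transition only to have a total function. -/
def blockStep (θ : ℝ≥0) (K : ℕ) : State → PMF State
  | (0, _) => startService θ (min 1 K)
  | (q + 1, r + 2) => PMF.pure (min (q + 2) K, r + 1)
  | (q + 1, _) => startService θ (min (q + 1) K)

/-- The law of the state one block later. -/
def advance (θ : ℝ≥0) (K : ℕ) (μ : PMF State) : PMF State := μ.bind (blockStep θ K)

/-- The law of the state at the start of block `n`, from the state `x` in block `0`. -/
def stateLaw (θ : ℝ≥0) (K : ℕ) (x : State) (n : ℕ) : PMF State :=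
  (advance θ K)^[n] (PMF.pure x)

/-- `μ` is a stationary law of the finite-buffer queue. -/
def IsStationary (θ : ℝ≥0) (K : ℕ) (μ : PMF State) : Prop := advance θ K μ = μ

/-- The probability that the queue length is `j` when the state has law `μ`. -/
def queueProb (μ : PMF State) (j : ℕ) : ℝ := ((μ.map Prod.fst) j).toReal

/-- The summand with index `j + 1` in the series for `φ_k`, that is
`((j + 1) θ) ^ (k + j + 1) / (k + j + 1)! * exp (-(j + 1) θ)`. -/
def varphiTerm (θ : ℝ) (k j : ℕ) : ℝ :=
  ((j + 1 : ℕ) * θ) ^ (k + (j + 1)) / ((k + (j + 1))! : ℝ) * Real.exp (-((j + 1 : ℕ) * θ))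

/-- `φ_k = (1 - θ) ∑_{j ≥ 1} (j θ) ^ (k + j) / (k + j)! * exp (-j θ)` for `k ≥ 0`, and `φ_{-1} = 1`
(the values at `k < -1` are not used). -/
def varphi (θ : ℝ) : ℤ → ℝ
  | Int.ofNat k => (1 - θ) * ∑' j : ℕ, varphiTerm θ k j
  | Int.negSucc _ => 1

end FadingQueue

end

/-!
The proof has three ingredients.

*The numbers `φ_k`.* Write `F_k = 1 - φ_k` and let `p_m` be the Poisson weights of mean `θ`. Jensen's
identity `∑ n, ((n + l) θ) ^ n / n! * exp (-(n + l) θ) = 1 / (1 - θ)` (`hasSum_poisson_diagonal`) and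
the convolution of Poisson laws give `F_0 = 1 - θ` (`queueCdf_zero`) and
`F_q = ∑_{m ≤ q} p_m F_{q + 1 - m}` (`queueCdf_eq_sum`). This recurrence is the balance equation of
the queue at its departures, summed over the queue lengths up to `q`, and it makes `F` positive and
increasing.

*The stationary law.* Let services begin with `1` packet at rate `F_1`, and with `i ≥ 2` packets at
rate `F_i - F_{i - 1}`, for `i ≤ K`, and let the queue be empty at rate `F_0`. By the recurrence these
rates balance at the departures, also when the overflow is collected at `K`
(`sum_serviceRate_balance`). The expected occupation of the states during these services, with the
idle time, is then an invariant measure (`lintegral_occupation_blockStep`). Its mass is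
`F_0 + θ F_K = 1 - θ φ_K` for `K ≥ 1`, and it gives the queue length `0` the weight `F_0`
and a length `1 ≤ j < K` the weight `F_j - F_{j - 1}`; the weight of `K` is what is left of the total mass.

*Uniqueness and convergence.* Let `h (x, y)` be the probability that two independent copies of the
chain, started at `x` and `y`, are ever empty at the same time. It is superharmonic for the product
chain, hence harmonic at every pair of states charged by the stationary law; as `h = 1` at the pair
of empty states, `h = 1` at all pairs that can be reached from it
(`meetLim_eq_one_of_stationary`), and these are entered from every pair
(`meetLim_blockStep_eq_one`). By the coupling inequality all initial laws then lead to the same limit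
(`tendsto_expect_chainLaw`, `eq_of_stationary`).
-/

noncomputable section

namespace FadingQueue

/-! ### Jensen's series -/

lemma mul_exp_one_sub_lt_one {t : ℝ} (h : t < 1) : t * Real.exp (1 - t) < 1 := by
  have := Real.add_one_lt_exp (x := t - 1) (by linarith)
  rw [← neg_sub t 1, Real.exp_neg, ← div_eq_mul_inv, div_lt_one (Real.exp_pos _)]
  linarith

lemma pow_div_factorial_le_exp_add (n l : ℕ) :
    ((n + l : ℕ) : ℝ) ^ n / (n ! : ℝ) ≤ Real.exp 1 ^ n * Real.exp l := by
  refine (Real.pow_div_factorial_le_exp (x := ((n + l : ℕ) : ℝ)) (by positivity) n).trans_eq ?_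
  rw [← Real.exp_nat_mul, ← Real.exp_add]
  push_cast; ring_nf

/-- The coefficient of `t ^ N` in Jensen's series is, up to the factor `1 / N!`, the `N`-th finite
difference of `x ↦ x ^ N`, hence it is `1`. -/
lemma sum_antidiagonal_pow_mul_neg_pow (l N : ℕ) (t : ℝ) :
    ∑ q ∈ Finset.HasAntidiagonal.antidiagonal N, (((q.1 + l : ℕ) : ℝ) * t) ^ q.1 / (q.1 ! : ℝ) *
      ((-(((q.1 + l : ℕ) : ℝ) * t)) ^ q.2 / (q.2 ! : ℝ)) = t ^ N := by
  have h := congrFun (fwdDiff_iter_eq_factorial (R := ℝ) (n := N)) (l : ℝ)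
  rw [fwdDiff_iter_eq_sum_shift] at h
  rw [Finset.Nat.sum_antidiagonal_eq_sum_range_succ_mk]
  have hN : (N ! : ℝ) ≠ 0 := by positivity
  rw [Pi.natCast_apply] at h
  have h2 := congrArg (t ^ N / (N ! : ℝ) * ·) h
  simp only [div_mul_cancel₀ _ hN, Finset.mul_sum] at h2
  rw [← h2]
  refine Finset.sum_congr rfl fun k hk => ?_
  have hk' : k ≤ N := Nat.lt_succ_iff.mp (Finset.mem_range.mp hk)
  have h4 : (N.choose k : ℝ) = N ! / (k ! * (N - k)!) := Nat.cast_choose ℝ hk'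
  clear h h2
  rw [zsmul_eq_mul]
  push_cast
  rw [h4, neg_pow, mul_pow, mul_pow]
  obtain ⟨m, rfl⟩ := Nat.exists_eq_add_of_le hk'
  simp only [Nat.add_sub_cancel_left, nsmul_eq_mul, mul_one]
  rw [add_comm (l : ℝ) k, pow_add t, pow_add ((k : ℝ) + l)]
  field_simp

/-- Jensen's series for small `t`: there, expanding the exponentials leaves an absolutely convergent
double series, which may be summed by powers of `t`. -/
lemma hasSum_poisson_diagonal_of_lt (l : ℕ) {t : ℝ} (h0 : 0 < t) (h1 : t < 1 / 8) :
    HasSum (fun n : ℕ => (((n + l : ℕ) : ℝ) * t) ^ n / (n ! : ℝ) *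
      Real.exp (-(((n + l : ℕ) : ℝ) * t))) (1 - t)⁻¹ := by
  set f : ℕ × ℕ → ℝ := fun q => (((q.1 + l : ℕ) : ℝ) * t) ^ q.1 / (q.1 ! : ℝ) *
      ((-(((q.1 + l : ℕ) : ℝ) * t)) ^ q.2 / (q.2 ! : ℝ)) with hf
  have hexp : ∀ x : ℝ, HasSum (fun m : ℕ => x ^ m / (m ! : ℝ)) (Real.exp x) := fun x => by
    rw [Real.exp_eq_exp_ℝ]; exact NormedSpace.expSeries_div_hasSum_exp x
  have hn : ∀ q, ‖f q‖ = (((q.1 + l : ℕ) : ℝ) * t) ^ q.1 / (q.1 ! : ℝ) *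
      ((((q.1 + l : ℕ) : ℝ) * t) ^ q.2 / (q.2 ! : ℝ)) := fun q => by
    simp only [hf, norm_mul, norm_div, norm_pow, norm_neg, Real.norm_eq_abs, Nat.abs_cast,
      abs_of_pos h0]
  have hs : Summable f := by
    apply Summable.of_norm
    simp_rw [hn]
    have hnn : ∀ q : ℕ × ℕ, 0 ≤ (((q.1 + l : ℕ) : ℝ) * t) ^ q.1 / (q.1 ! : ℝ) *
      ((((q.1 + l : ℕ) : ℝ) * t) ^ q.2 / (q.2 ! : ℝ)) := fun q => by positivity
    refine (summable_prod_of_nonneg hnn).mpr ?_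
    refine ⟨fun n => (hexp (((n + l : ℕ) : ℝ) * t)).summable.mul_left
      ((((n + l : ℕ) : ℝ) * t) ^ n / (n ! : ℝ)), ?_⟩
    have hr : t * Real.exp 2 < 1 := by
      have : Real.exp 2 < 8 := by
        have h := Real.exp_one_lt_d9
        have : Real.exp 2 = Real.exp 1 * Real.exp 1 := by rw [← Real.exp_add]; norm_num
        rw [this]; nlinarith [Real.exp_pos 1]
      nlinarith [Real.exp_pos 2]
    refine Summable.of_nonneg_of_le (fun n => by positivity) (fun n => ?_)
      ((summable_geometric_of_lt_one (by positivity) hr).mul_right (Real.exp (2 * l)))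
    dsimp only
    rw [tsum_mul_left, (hexp (((n + l : ℕ) : ℝ) * t)).tsum_eq, mul_pow, mul_div_right_comm]
    have hb := pow_div_factorial_le_exp_add n l
    have he : Real.exp (((n + l : ℕ) : ℝ) * t) ≤ Real.exp 1 ^ n * Real.exp l := by
      rw [← Real.exp_nat_mul, ← Real.exp_add]
      apply Real.exp_le_exp.mpr
      push_cast
      nlinarith [(Nat.cast_nonneg n : (0 : ℝ) ≤ n), (Nat.cast_nonneg l : (0 : ℝ) ≤ l)]
    calc ((n + l : ℕ) : ℝ) ^ n / (n ! : ℝ) * t ^ n * Real.exp (((n + l : ℕ) : ℝ) * t)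
        ≤ (Real.exp 1 ^ n * Real.exp l) * t ^ n * (Real.exp 1 ^ n * Real.exp l) := by gcongr
      _ = (t * Real.exp 2) ^ n * Real.exp (2 * l) := by
        have h2 : Real.exp 2 = Real.exp 1 * Real.exp 1 := by rw [← Real.exp_add]; norm_num
        rw [h2, two_mul, Real.exp_add]; ring
  have hinner : ∀ n, HasSum (fun m => f (n, m)) ((((n + l : ℕ) : ℝ) * t) ^ n / (n ! : ℝ) *
      Real.exp (-(((n + l : ℕ) : ℝ) * t))) := fun n =>
    (hexp (-(((n + l : ℕ) : ℝ) * t))).mul_left ((((n + l : ℕ) : ℝ) * t) ^ n / (n ! : ℝ))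
  have hprod := hs.hasSum.prod_fiberwise hinner
  have hanti : HasSum (fun N => ∑ q ∈ Finset.HasAntidiagonal.antidiagonal N, f q) (∑' q, f q) := by
    have h := (Finset.HasAntidiagonal.sigmaAntidiagonalEquivProd (A := ℕ)).hasSum_iff.mpr hs.hasSum
    have h2 := h.sigma fun N => hasSum_fintype _
    convert h2 using 2 with N
    exact (Finset.sum_coe_sort (Finset.HasAntidiagonal.antidiagonal N) f).symm
  have hg : HasSum (fun N : ℕ => t ^ N) (1 - t)⁻¹ :=
    hasSum_geometric_of_lt_one h0.le (by linarith)
  simp only [hf, sum_antidiagonal_pow_mul_neg_pow] at hanti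
  rw [← hanti.unique hg]
  exact hprod

/-- The sum of Jensen's series is real analytic on `(0, 1)`: for complex `z` the series converges
locally uniformly where `|z * exp (1 - z)| < 1`. -/
lemma analyticOnNhd_poisson_diagonal (l : ℕ) :
    AnalyticOnNhd ℝ (fun t : ℝ => (∑' n : ℕ, (((n + l : ℕ) : ℂ) * t) ^ n / (n ! : ℂ) *
      Complex.exp (-(((n + l : ℕ) : ℂ) * t))).re) (Set.Ioo 0 1) := by
  intro t ht
  have hr := mul_exp_one_sub_lt_one ht.2
  obtain ⟨ρ, hρ1, hρ2⟩ := exists_between hr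
  have hρ0 : 0 < ρ := lt_of_le_of_lt (mul_nonneg ht.1.le (Real.exp_pos _).le) hρ1
  set U : Set ℂ := {z | ‖z * Complex.exp (1 - z)‖ < ρ ∧ -1 < z.re} with hU
  have hUo : IsOpen U := by
    apply IsOpen.inter
    · exact isOpen_lt (by fun_prop : Continuous fun z : ℂ => ‖z * Complex.exp (1 - z)‖) continuous_const
    · exact isOpen_lt continuous_const Complex.continuous_re
  have htU : (t : ℂ) ∈ U := by
    refine ⟨?_, by simpa using by linarith [ht.1]⟩
    rw [norm_mul, Complex.norm_exp]
    simpa [abs_of_pos ht.1] using hρ1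
  -- The terms are at most `|z exp (1 - z)| ^ n * exp (2 * l)` on `U`; the bound `-1 < re z` serves
  -- only for the factor `exp (-l z)`.
  have hd := Complex.differentiableOn_tsum_of_summable_norm (ι := ℕ) (U := U)
    (F := fun n z => (((n + l : ℕ) : ℂ) * z) ^ n / (n ! : ℂ) *
      Complex.exp (-(((n + l : ℕ) : ℂ) * z)))
    (u := fun n => ρ ^ n * Real.exp (2 * l))
    ((summable_geometric_of_lt_one hρ0.le hρ2).mul_right _)
    (fun n => by fun_prop) hUo (fun n z hz => by
      have hz1 : (‖z‖ * Real.exp (1 - z.re)) ^ n ≤ ρ ^ n := by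
        have := hz.1
        rw [norm_mul, Complex.norm_exp] at this
        exact pow_le_pow_left₀ (by positivity) (by simpa using this.le) n
      have hb := pow_div_factorial_le_exp_add n l
      rw [norm_mul, Complex.norm_exp, norm_div, norm_pow, norm_mul, Complex.norm_natCast,
        Complex.norm_natCast, mul_pow, mul_div_right_comm]
      have hre : (-(((n + l : ℕ) : ℂ) * z)).re = n * (-z.re) + l * (-z.re) := by
        simp; ring
      rw [hre, Real.exp_add, Real.exp_nat_mul]
      have hl : Real.exp (l * (-z.re)) ≤ Real.exp l := by
        apply Real.exp_le_exp.mpr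
        nlinarith [hz.2, (Nat.cast_nonneg l : (0 : ℝ) ≤ l)]
      calc ((n + l : ℕ) : ℝ) ^ n / (n ! : ℝ) * ‖z‖ ^ n *
            (Real.exp (-z.re) ^ n * Real.exp (l * (-z.re)))
          ≤ (Real.exp 1 ^ n * Real.exp l) * ‖z‖ ^ n * (Real.exp (-z.re) ^ n * Real.exp l) := by
            gcongr
        _ = (‖z‖ * Real.exp (1 - z.re)) ^ n * Real.exp (2 * l) := by
          rw [sub_eq_add_neg, Real.exp_add, two_mul, Real.exp_add]; ring
        _ ≤ ρ ^ n * Real.exp (2 * l) := by gcongr)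
  have ha := (hd.analyticOnNhd hUo) t htU
  exact ha.re_ofReal

/-- **Jensen's identity**: `∑ n, ((n + l) t) ^ n / n! * exp (-(n + l) t) = 1 / (1 - t)` for
`0 < t < 1`. It holds for small `t` by rearrangement and on `(0, 1)` by analytic continuation.
In probabilistic terms, the mean number of visits to a level `l` of the skip-free random walk with
steps `1 - T`, `T` Poisson of mean `t`, does not depend on `l`. -/
theorem hasSum_poisson_diagonal (l : ℕ) {t : ℝ} (h0 : 0 < t) (h1 : t < 1) :
    HasSum (fun n : ℕ => (((n + l : ℕ) : ℝ) * t) ^ n / (n ! : ℝ) *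
      Real.exp (-(((n + l : ℕ) : ℝ) * t))) (1 - t)⁻¹ := by
  have hre : ∀ s : ℝ, (∑' n : ℕ, (((n + l : ℕ) : ℂ) * s) ^ n / (n ! : ℂ) *
      Complex.exp (-(((n + l : ℕ) : ℂ) * s))).re = ∑' n : ℕ, (((n + l : ℕ) : ℝ) * s) ^ n / (n ! : ℝ) *
      Real.exp (-(((n + l : ℕ) : ℝ) * s)) := fun s => by
    rw [← Complex.ofReal_re (∑' n : ℕ, (((n + l : ℕ) : ℝ) * s) ^ n / (n ! : ℝ) *
      Real.exp (-(((n + l : ℕ) : ℝ) * s))), Complex.ofReal_tsum]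
    push_cast; rfl
  have hs : Summable (fun n : ℕ => (((n + l : ℕ) : ℝ) * t) ^ n / (n ! : ℝ) *
      Real.exp (-(((n + l : ℕ) : ℝ) * t))) := by
    have hr := mul_exp_one_sub_lt_one h1
    refine Summable.of_nonneg_of_le (fun n => by positivity) (fun n => ?_)
      ((summable_geometric_of_lt_one (by positivity) hr).mul_right (Real.exp l))
    have hb := pow_div_factorial_le_exp_add n l
    have he : Real.exp (-(((n + l : ℕ) : ℝ) * t)) ≤ Real.exp (-t) ^ n := by
      rw [← Real.exp_nat_mul]
      apply Real.exp_le_exp.mpr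
      push_cast
      nlinarith [(Nat.cast_nonneg l : (0 : ℝ) ≤ l)]
    rw [mul_pow, mul_div_right_comm]
    calc ((n + l : ℕ) : ℝ) ^ n / (n ! : ℝ) * t ^ n * Real.exp (-(((n + l : ℕ) : ℝ) * t))
        ≤ (Real.exp 1 ^ n * Real.exp l) * t ^ n * Real.exp (-t) ^ n := by gcongr
      _ = (t * Real.exp (1 - t)) ^ n * Real.exp l := by
        rw [sub_eq_add_neg, Real.exp_add]; ring
  -- Near `1 / 16` the two sides agree by `hasSum_poisson_diagonal_of_lt`.
  have heq := (analyticOnNhd_poisson_diagonal l).eqOn_of_preconnected_of_eventuallyEq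
    (g := fun t : ℝ => (1 - t)⁻¹)
    (fun x hx => by
      have : (1 - x) ≠ 0 := by linarith [hx.2]
      fun_prop (disch := assumption))
    isPreconnected_Ioo (z₀ := 1 / 16) (by norm_num) (by
      filter_upwards [Ioo_mem_nhds (show (0 : ℝ) < 1 / 16 by norm_num)
        (show (1 / 16 : ℝ) < 1 / 8 by norm_num)] with s hs
      rw [hre]
      exact (hasSum_poisson_diagonal_of_lt l hs.1 hs.2).tsum_eq)
  have := heq ⟨h0, h1⟩
  simp only [hre] at this
  rw [← this]
  exact hs.hasSum

/-! ### Poisson weights and the numbers `φ_k` -/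

/-- The Poisson weight `x ^ n / n! * exp (-x)`. -/
def poissonWeight (x : ℝ) (n : ℕ) : ℝ := x ^ n / (n ! : ℝ) * Real.exp (-x)

lemma poissonWeight_nonneg {x : ℝ} (hx : 0 ≤ x) (n : ℕ) : 0 ≤ poissonWeight x n := by
  unfold poissonWeight; positivity

lemma poissonWeight_pos {x : ℝ} (hx : 0 < x) (n : ℕ) : 0 < poissonWeight x n := by
  unfold poissonWeight; positivity

lemma hasSum_poissonWeight (x : ℝ) : HasSum (poissonWeight x) 1 := by
  have h := (NormedSpace.expSeries_div_hasSum_exp x).mul_right (Real.exp (-x))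
  rw [← Real.exp_eq_exp_ℝ, ← Real.exp_add, add_neg_cancel, Real.exp_zero] at h
  exact h

lemma poissonWeight_add (x y : ℝ) (n : ℕ) :
    poissonWeight (x + y) n =
      ∑ m ∈ Finset.range (n + 1), poissonWeight x m * poissonWeight y (n - m) := by
  unfold poissonWeight
  rw [add_pow, Finset.sum_div, Finset.sum_mul]
  refine Finset.sum_congr rfl fun m hm => ?_
  have hm' : m ≤ n := Nat.lt_succ_iff.mp (Finset.mem_range.mp hm)
  rw [Nat.cast_choose ℝ hm', neg_add, Real.exp_add]
  field_simp

lemma varphiTerm_eq (θ : ℝ) (k j : ℕ) :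
    varphiTerm θ k j = poissonWeight ((j + 1 : ℕ) * θ) (k + (j + 1)) := rfl

lemma summable_varphiTerm {θ : ℝ} (h0 : 0 < θ) (h1 : θ < 1) (k : ℕ) :
    Summable (varphiTerm θ k) := by
  have hr := mul_exp_one_sub_lt_one h1
  have hr0 : 0 ≤ θ * Real.exp (1 - θ) := by positivity
  refine Summable.of_nonneg_of_le (fun j => ?_) (fun j => ?_)
    ((summable_geometric_of_lt_one hr0 hr).mul_right (Real.exp (k * θ)))
  · unfold varphiTerm; positivity
  · unfold varphiTerm
    set n := k + (j + 1) with hn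
    calc ((j + 1 : ℕ) * θ) ^ n / (n ! : ℝ) * Real.exp (-((j + 1 : ℕ) * θ))
        ≤ ((n : ℝ) * θ) ^ n / (n ! : ℝ) * Real.exp (-((j + 1 : ℕ) * θ)) := by
          have : ((j + 1 : ℕ) : ℝ) ≤ n := by exact_mod_cast (by omega : j + 1 ≤ n)
          gcongr
      _ = θ ^ n * ((n : ℝ) ^ n / (n ! : ℝ)) * Real.exp (-((j + 1 : ℕ) * θ)) := by ring
      _ ≤ θ ^ n * Real.exp n * Real.exp (-((j + 1 : ℕ) * θ)) := by
          have := Real.pow_div_factorial_le_exp (x := (n : ℝ)) (by positivity) n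
          gcongr
      _ = (θ * Real.exp (1 - θ)) ^ n * Real.exp (k * θ) := by
          rw [mul_pow, ← Real.exp_nat_mul, mul_assoc, mul_assoc, ← Real.exp_add, ← Real.exp_add]
          congr 2
          rw [hn]; push_cast; ring
      _ ≤ (θ * Real.exp (1 - θ)) ^ j * Real.exp (k * θ) := by
          have := pow_le_pow_of_le_one hr0 hr.le (show j ≤ n by omega)
          gcongr

lemma hasSum_varphiTerm_zero {θ : ℝ} (h0 : 0 < θ) (h1 : θ < 1) :
    HasSum (varphiTerm θ 0) ((1 - θ)⁻¹ - 1) := by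
  have h := (hasSum_nat_add_iff' 1).mpr (hasSum_poisson_diagonal 0 h0 h1)
  simp only [Finset.range_one, Finset.sum_singleton, pow_zero, Nat.factorial_zero, add_zero,
    Nat.cast_zero, zero_mul, neg_zero, Real.exp_zero, Nat.cast_one, div_one, mul_one] at h
  refine HasSum.congr_fun (h) fun j => ?_
  rw [varphiTerm_eq, poissonWeight, zero_add]

/-- Jensen's identity with the terms indexed by the rate of the Poisson weight. -/
lemma hasSum_poissonWeight_shift {θ : ℝ} (h0 : 0 < θ) (h1 : θ < 1) (l : ℕ) :
    HasSum (fun i : ℕ => if l ≤ i then poissonWeight ((i + 1 : ℕ) * θ) (i - l) else 0)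
      (1 - θ)⁻¹ := by
  rw [← (add_left_injective l).hasSum_iff]
  · have := hasSum_poisson_diagonal (l + 1) h0 h1
    simpa [Function.comp_def, poissonWeight, add_assoc] using this
  · intro i hi
    rw [if_neg]
    intro hl
    exact hi ⟨i - l, Nat.sub_add_cancel hl⟩

/-- The recurrence for the series in `φ_q`. Its first term is a Poisson weight of mean `θ`; in the
later ones the Poisson law of mean `(i + 2) θ` is the convolution of those of means `θ` and
`(i + 1) θ`. Summation over `i` first gives the series in `φ_{q + 1 - m}` for `m ≤ q + 1`, and
Jensen's sum `1 / (1 - θ)` for `m > q + 1`. -/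
lemma tsum_varphiTerm_eq {θ : ℝ} (h0 : 0 < θ) (h1 : θ < 1) (q : ℕ) :
    ∑' j, varphiTerm θ q j = poissonWeight θ (q + 1) * (1 - θ)⁻¹ +
      ∑ m ∈ Finset.range (q + 1), poissonWeight θ m * ∑' j, varphiTerm θ (q + 1 - m) j +
      (1 - ∑ m ∈ Finset.range (q + 2), poissonWeight θ m) * (1 - θ)⁻¹ := by
  set p := poissonWeight θ with hp
  have hp0 : ∀ m, 0 ≤ p m := poissonWeight_nonneg h0.le
  set G : ℕ → ℕ → ℝ := fun m i => p m *
    if m ≤ q + i + 2 then poissonWeight ((i + 1 : ℕ) * θ) (q + i + 2 - m) else 0 with hG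
  set s : ℕ → ℝ := fun m => if m ≤ q + 1 then ∑' j, varphiTerm θ (q + 1 - m) j
    else (1 - θ)⁻¹ with hs
  have hGs : ∀ m, HasSum (G m) (p m * s m) := by
    intro m
    refine HasSum.mul_left _ ?_
    by_cases hm : m ≤ q + 1
    · simp only [hs, if_pos hm]
      refine HasSum.congr_fun ((summable_varphiTerm h0 h1 (q + 1 - m)).hasSum) fun i => ?_
      rw [if_pos (by omega), varphiTerm_eq]
      congr 1; omega
    · simp only [hs, if_neg hm]
      refine HasSum.congr_fun ((hasSum_poissonWeight_shift h0 h1 (m - q - 2))) fun i => ?_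
      by_cases hi : m ≤ q + i + 2
      · rw [if_pos hi, if_pos (by omega)]
        congr 1; omega
      · rw [if_neg hi, if_neg (by omega)]
  have hG0 : ∀ x : ℕ × ℕ, 0 ≤ Function.uncurry G x := fun x => by
    simp only [Function.uncurry, hG]
    refine mul_nonneg (hp0 _) ?_
    split_ifs
    · exact poissonWeight_nonneg (by positivity) _
    · exact le_rfl
  have htail : HasSum (fun m => p (m + (q + 2)) * s (m + (q + 2)))
      ((1 - ∑ m ∈ Finset.range (q + 2), p m) * (1 - θ)⁻¹) := by
    have h := ((hasSum_nat_add_iff' (q + 2)).mpr (hasSum_poissonWeight θ)).mul_right (1 - θ)⁻¹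
    refine HasSum.congr_fun (h) fun m => ?_
    simp only [hs]
    rw [if_neg (by omega)]
  have htot := (hasSum_nat_add_iff (f := fun m => p m * s m) (q + 2)).mp htail
  have hsum : Summable (Function.uncurry G) := by
    refine (summable_prod_of_nonneg hG0).mpr ⟨fun m => (hGs m).summable, ?_⟩
    have : (fun m => ∑' i, Function.uncurry G (m, i)) = fun m => p m * s m :=
      funext fun m => (hGs m).tsum_eq
    rw [this]; exact htot.summable
  have hcol : ∀ i, ∑' m, G m i = varphiTerm θ q (i + 1) := by
    intro i
    rw [tsum_eq_sum (s := Finset.range (q + i + 2 + 1))]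
    · rw [varphiTerm_eq]
      have : ((i + 1 + 1 : ℕ) : ℝ) * θ = θ + ((i + 1 : ℕ) : ℝ) * θ := by push_cast; ring
      rw [this, poissonWeight_add, show q + (i + 1 + 1) = q + i + 2 by ring]
      refine Finset.sum_congr rfl fun m hm => ?_
      have := Finset.mem_range.mp hm
      simp only [hG]
      rw [if_pos (by omega)]
    · intro m hm
      have := mt Finset.mem_range.mpr hm
      simp only [hG]
      rw [if_neg (by omega), mul_zero]
  have hswap : ∑' i, ∑' m, G m i = ∑' m, ∑' i, G m i := hsum.tsum_comm
  simp only [hcol, (hGs _).tsum_eq] at hswap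
  have hA0 : s (q + 1) = (1 - θ)⁻¹ - 1 := by
    simp only [hs, le_refl, if_true, Nat.sub_self]
    exact (hasSum_varphiTerm_zero h0 h1).tsum_eq
  have hsm : ∑ m ∈ Finset.range (q + 1), p m * s m =
      ∑ m ∈ Finset.range (q + 1), p m * ∑' j, varphiTerm θ (q + 1 - m) j :=
    Finset.sum_congr rfl fun m hm => by
      have := Finset.mem_range.mp hm
      simp only [hs]
      rw [if_pos (by omega)]
  have hv0 : varphiTerm θ q 0 = p (q + 1) := by simp [varphiTerm_eq, hp]
  rw [(summable_varphiTerm h0 h1 q).tsum_eq_zero_add, hswap, htot.tsum_eq,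
    Finset.sum_range_succ _ (q + 1), Finset.sum_range_succ _ (q + 1)]
  rw [hA0, hsm, hv0]
  ring

/-- `1 - φ_k`. This is the stationary probability of at most `k` packets in the queue with an
infinite buffer, which is where the monotonicity and the recurrence below come from. -/
def queueCdf (θ : ℝ) (k : ℕ) : ℝ := 1 - varphi θ k

lemma varphi_natCast (θ : ℝ) (k : ℕ) : varphi θ k = (1 - θ) * ∑' j, varphiTerm θ k j := rfl

lemma varphi_eq (θ : ℝ) (k : ℕ) : varphi θ k = 1 - queueCdf θ k := by
  unfold queueCdf; ring

lemma queueCdf_zero {θ : ℝ} (h0 : 0 < θ) (h1 : θ < 1) : queueCdf θ 0 = 1 - θ := by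
  rw [queueCdf, varphi_natCast, (hasSum_varphiTerm_zero h0 h1).tsum_eq]
  have : 1 - θ ≠ 0 := by linarith
  field_simp; ring

/-- Balance of the departure chain: `F_q = ∑_{m ≤ q} p_m F_{q + 1 - m}` for `F_k = 1 - φ_k` and the
Poisson weights `p_m`. -/
theorem queueCdf_eq_sum {θ : ℝ} (h0 : 0 < θ) (h1 : θ < 1) (q : ℕ) :
    queueCdf θ q =
      ∑ m ∈ Finset.range (q + 1), poissonWeight θ m * queueCdf θ (q + 1 - m) := by
  have h : 1 - θ ≠ 0 := by linarith
  have hsum : ∑ m ∈ Finset.range (q + 1), poissonWeight θ m * queueCdf θ (q + 1 - m) =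
      ∑ m ∈ Finset.range (q + 1), poissonWeight θ m - (1 - θ) *
        ∑ m ∈ Finset.range (q + 1), poissonWeight θ m * ∑' j, varphiTerm θ (q + 1 - m) j := by
    rw [Finset.mul_sum, ← Finset.sum_sub_distrib]
    refine Finset.sum_congr rfl fun m _ => ?_
    rw [queueCdf, varphi_natCast]; ring
  rw [hsum, queueCdf, varphi_natCast, tsum_varphiTerm_eq h0 h1, Finset.sum_range_succ _ (q + 1)]
  field_simp; ring

/-- The recurrence `queueCdf_eq_sum` determines `F_{q + 1}` from `F_0, …, F_q`, and since the weights
have sum at most `1`, it keeps the sequence increasing. -/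
lemma queueCdf_pos_and_le_succ {θ : ℝ} (h0 : 0 < θ) (h1 : θ < 1) (q : ℕ) :
    0 < queueCdf θ q ∧ queueCdf θ q ≤ queueCdf θ (q + 1) := by
  induction q using Nat.strong_induction_on with
  | _ q ih =>
    have hp0 : ∀ m, 0 < poissonWeight θ m := poissonWeight_pos h0
    have hpos : 0 < queueCdf θ q := by
      rcases q with _ | q
      · rw [queueCdf_zero h0 h1]; linarith
      · exact (ih q (by omega)).1.trans_le (ih q (by omega)).2
    refine ⟨hpos, ?_⟩
    have hmono : ∀ i, i ≤ q → queueCdf θ i ≤ queueCdf θ q := fun i hi => by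
      induction hi using Nat.decreasingInduction with
      | self => exact le_rfl
      | of_succ k hk hle => exact (ih k hk).2.trans hle
    have hrec := queueCdf_eq_sum h0 h1 q
    rw [Finset.sum_range_succ', Nat.sub_zero] at hrec
    have hle : ∑ m ∈ Finset.range q, poissonWeight θ (m + 1) * queueCdf θ (q + 1 - (m + 1)) ≤
        (∑ m ∈ Finset.range q, poissonWeight θ (m + 1)) * queueCdf θ q := by
      rw [Finset.sum_mul]
      exact Finset.sum_le_sum fun m _ =>
        mul_le_mul_of_nonneg_left (hmono _ (by omega)) (hp0 _).le
    have hone : ∑ m ∈ Finset.range q, poissonWeight θ (m + 1) + poissonWeight θ 0 ≤ 1 := by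
      rw [← Finset.sum_range_succ']
      exact sum_le_hasSum _ (fun m _ => (hp0 m).le) (hasSum_poissonWeight θ)
    have : poissonWeight θ 0 * queueCdf θ q ≤ poissonWeight θ 0 * queueCdf θ (q + 1) := by
      nlinarith
    exact le_of_mul_le_mul_left this (hp0 0)

/-! ### Balance of the departure chain with a finite buffer -/

/-- The rate of the services that begin with at most `n` packets present. It agrees with
`queueCdf` except at `0`: a service begins only when there is a packet. -/
def serviceCdf (θ : ℝ) : ℕ → ℝ
  | 0 => 0
  | n + 1 => queueCdf θ (n + 1)

/-- The rate, before normalization, of the services that begin with `i + 1` packets present. -/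
def serviceRate (θ : ℝ) (i : ℕ) : ℝ := serviceCdf θ (i + 1) - serviceCdf θ i

lemma serviceRate_nonneg {θ : ℝ} (h0 : 0 < θ) (h1 : θ < 1) (i : ℕ) : 0 ≤ serviceRate θ i := by
  have h := queueCdf_pos_and_le_succ h0 h1
  rcases i with _ | i
  · simpa [serviceRate, serviceCdf] using (h 1).1.le
  · simpa [serviceRate, serviceCdf] using (h (i + 1)).2

lemma sum_serviceRate (θ : ℝ) (n : ℕ) :
    ∑ i ∈ Finset.range n, serviceRate θ i = serviceCdf θ n := by
  simp only [serviceRate]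
  rw [Finset.sum_range_sub, serviceCdf, sub_zero]

lemma sum_serviceRate_mul_sum {θ : ℝ} (h0 : 0 < θ) (h1 : θ < 1) (q : ℕ) :
    ∑ i ∈ Finset.range (q + 1), serviceRate θ i * ∑ k ∈ Finset.range (q + 1 - i), poissonWeight θ k
      = queueCdf θ q := by
  rw [queueCdf_eq_sum h0 h1]
  simp only [Finset.mul_sum]
  rw [Finset.sum_comm' (t' := Finset.range (q + 1)) (s' := fun k => Finset.range (q + 1 - k))
    (by intro i k; simp only [Finset.mem_range]; omega)]
  refine Finset.sum_congr rfl fun k hk => ?_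
  have := Finset.mem_range.mp hk
  rw [← Finset.sum_mul, sum_serviceRate, mul_comm,
    show q + 1 - k = (q - k) + 1 by omega, serviceCdf]

/-- The sum over the services that last long enough for their queue to pass through the length
`q + 1`; it becomes the weight of that length in the stationary law. -/
lemma sum_serviceRate_mul_tail {θ : ℝ} (h0 : 0 < θ) (h1 : θ < 1) (q : ℕ) :
    ∑ i ∈ Finset.range (q + 1), serviceRate θ i *
      (1 - ∑ k ∈ Finset.range (q + 1 - i), poissonWeight θ k) =
      queueCdf θ (q + 1) - queueCdf θ q := by
  simp only [mul_sub, mul_one, Finset.sum_sub_distrib]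
  rw [sum_serviceRate_mul_sum h0 h1, sum_serviceRate, serviceCdf]

/-- Balance of the departure chain with buffer size `K + 1`, tested against a function `w`. A service
that begins with `i + 1` packets and lasts `k` blocks leaves `min (i + k) (K + 1)` packets, and the
term `queueCdf θ 0 * w 1` accounts for the arrivals at an empty queue. -/
theorem sum_serviceRate_balance {θ : ℝ} (h0 : 0 < θ) (h1 : θ < 1) (w : ℕ → ℝ) (K : ℕ) :
    queueCdf θ 0 * w 1 + ∑ i ∈ Finset.range (K + 1), serviceRate θ i *
      (∑ k ∈ Finset.range (K + 1 - i), poissonWeight θ k * w (i + k) +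
        (1 - ∑ k ∈ Finset.range (K + 1 - i), poissonWeight θ k) * w (K + 1)) =
    queueCdf θ 0 * w 0 + ∑ i ∈ Finset.range (K + 1), serviceRate θ i * w (i + 1) := by
  induction K with
  | zero =>
    have h := queueCdf_eq_sum h0 h1 0
    simp [serviceRate, serviceCdf] at h ⊢
    rw [h]; ring
  | succ K ih =>
    rw [Finset.sum_range_succ _ (K + 1), Finset.sum_range_succ _ (K + 1), ← add_assoc, ← add_assoc,
      ← ih]
    have hstep : ∀ i ∈ Finset.range (K + 1), serviceRate θ i *
        (∑ k ∈ Finset.range (K + 1 + 1 - i), poissonWeight θ k * w (i + k) +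
        (1 - ∑ k ∈ Finset.range (K + 1 + 1 - i), poissonWeight θ k) * w (K + 1 + 1)) =
        serviceRate θ i * (∑ k ∈ Finset.range (K + 1 - i), poissonWeight θ k * w (i + k) +
        (1 - ∑ k ∈ Finset.range (K + 1 - i), poissonWeight θ k) * w (K + 1)) +
        serviceRate θ i * (1 - ∑ k ∈ Finset.range (K + 1 + 1 - i), poissonWeight θ k) *
          (w (K + 1 + 1) - w (K + 1)) := by
      intro i hi
      have := Finset.mem_range.mp hi
      rw [show K + 1 + 1 - i = (K + 1 - i) + 1 by omega, Finset.sum_range_succ,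
        Finset.sum_range_succ, show i + (K + 1 - i) = K + 1 by omega]
      ring
    rw [Finset.sum_congr rfl hstep, Finset.sum_add_distrib, ← Finset.sum_mul]
    have ht := sum_serviceRate_mul_tail h0 h1 (K + 1)
    rw [Finset.sum_range_succ] at ht
    have hr : serviceRate θ (K + 1) = queueCdf θ (K + 1 + 1) - queueCdf θ (K + 1) := rfl
    rw [← hr] at ht
    simp only [show K + 1 + 1 - (K + 1) = 1 by omega, Finset.sum_range_one, add_zero] at ht ⊢
    linear_combination (w (K + 1 + 1) - w (K + 1)) * ht

/-! ### Markov chains whose independent copies meet -/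

section MarkovChain

variable {α β : Type*}

/-- The mean of a nonnegative function `f` under the probability mass function `p`. -/
def expect (p : PMF α) (f : α → ℝ≥0∞) : ℝ≥0∞ := ∑' x, p x * f x

lemma expect_const (p : PMF α) (c : ℝ≥0∞) : expect p (fun _ => c) = c := by
  rw [expect, ENNReal.tsum_mul_right, p.tsum_coe, one_mul]

lemma expect_mono (p : PMF α) {f g : α → ℝ≥0∞} (h : ∀ x, f x ≤ g x) : expect p f ≤ expect p g :=
  ENNReal.tsum_le_tsum fun x => mul_le_mul_right (h x) _

lemma expect_le_one (p : PMF α) {f : α → ℝ≥0∞} (h : ∀ x, f x ≤ 1) : expect p f ≤ 1 :=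
  (expect_mono p h).trans_eq (expect_const p 1)

lemma expect_add (p : PMF α) (f g : α → ℝ≥0∞) :
    expect p (fun x => f x + g x) = expect p f + expect p g := by
  simp only [expect, mul_add, ENNReal.tsum_add]

lemma expect_pure (a : α) (f : α → ℝ≥0∞) : expect (PMF.pure a) f = f a := by
  rw [expect, tsum_eq_single a fun b hb => by rw [PMF.pure_apply_of_ne _ _ hb, zero_mul],
    PMF.pure_apply_self, one_mul]

lemma expect_bind (p : PMF α) (κ : α → PMF β) (f : β → ℝ≥0∞) :
    expect (p.bind κ) f = expect p fun x => expect (κ x) f := by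
  simp only [expect, PMF.bind_apply, ← ENNReal.tsum_mul_right, ← ENNReal.tsum_mul_left]
  rw [ENNReal.tsum_comm]
  simp only [mul_assoc]

lemma expect_comm (p : PMF α) (q : PMF β) (f : α → β → ℝ≥0∞) :
    (expect p fun x => expect q fun y => f x y) = expect q fun y => expect p fun x => f x y := by
  simp only [expect, ← ENNReal.tsum_mul_left]
  rw [ENNReal.tsum_comm]
  simp only [mul_left_comm]

lemma expect_iSup (p : PMF α) {f : ℕ → α → ℝ≥0∞} (hf : ∀ x, Monotone fun n => f n x) :
    expect p (fun x => ⨆ n, f n x) = ⨆ n, expect p (f n) := by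
  simp only [expect, ENNReal.mul_iSup, ENNReal.tsum_eq_iSup_sum]
  rw [iSup_comm]
  refine iSup_congr fun s => ENNReal.finsetSum_iSup_of_monotone fun x m n hmn => ?_
  exact mul_le_mul_right (hf x hmn) _

lemma expect_ite_eq (p : PMF α) [DecidableEq α] (a : α) :
    expect p (fun x => if x = a then 1 else 0) = p a := by
  rw [expect, tsum_eq_single a fun b hb => by rw [if_neg hb, mul_zero], if_pos rfl, mul_one]

/-- Two functions, one below the other, with the same finite mean agree at every atom. -/
lemma eq_of_expect_eq {p : PMF α} {f g : α → ℝ≥0∞} (hfg : ∀ x, f x ≤ g x) (hg : expect p g ≠ ∞)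
    (h : expect p f = expect p g) {x : α} (hx : p x ≠ 0) : f x = g x := by
  by_contra hne
  refine (ENNReal.tsum_lt_tsum (i := x) (h.trans_ne hg) (fun y => mul_le_mul_right (hfg y) (p y)) ?_).ne h
  exact (ENNReal.mul_lt_mul_iff_right hx (p.apply_ne_top x)).mpr (lt_of_le_of_ne (hfg x) hne)

lemma eq_one_of_expect_eq_one {p : PMF α} {f : α → ℝ≥0∞} (hf : ∀ x, f x ≤ 1) (h : expect p f = 1)
    {x : α} (hx : p x ≠ 0) : f x = 1 :=
  eq_of_expect_eq hf (by rw [expect_const]; exact ENNReal.one_ne_top)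
    (by rw [h, expect_const]) hx

variable (κ : α → PMF α) (a : α)

/-- The law after `n` steps of the Markov chain with transition law `κ` and initial law `p`. -/
def chainLaw (n : ℕ) (p : PMF α) : PMF α := (fun q : PMF α => q.bind κ)^[n] p

lemma chainLaw_succ (n : ℕ) (p : PMF α) : chainLaw κ (n + 1) p = (chainLaw κ n p).bind κ :=
  Function.iterate_succ_apply' _ _ _

lemma chainLaw_eq_bind (n : ℕ) (p : PMF α) :
    chainLaw κ n p = p.bind fun x => chainLaw κ n (PMF.pure x) := by
  induction n with
  | zero => exact p.bind_pure.symm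
  | succ n ih => simp only [chainLaw_succ]; rw [ih, PMF.bind_bind]

lemma chainLaw_succ_pure (n : ℕ) (x : α) :
    chainLaw κ (n + 1) (PMF.pure x) = (κ x).bind fun y => chainLaw κ n (PMF.pure y) := by
  rw [← chainLaw_eq_bind, chainLaw, Function.iterate_succ_apply, PMF.pure_bind]
  rfl

lemma chainLaw_of_stationary {p : PMF α} (hp : p.bind κ = p) (n : ℕ) : chainLaw κ n p = p :=
  Function.iterate_fixed hp n

variable {κ} in
lemma apply_ne_zero_of_stationary {μ : PMF α} (hμ : μ.bind κ = μ) {x y : α} (hx : μ x ≠ 0)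
    (hy : κ x y ≠ 0) : μ y ≠ 0 := by
  rw [← hμ]
  simp only [PMF.bind_apply, ne_eq, ENNReal.tsum_eq_zero, not_forall]
  exact ⟨x, mul_ne_zero hx hy⟩

variable [DecidableEq α]

/-- The probability that two independent copies of the chain, started at `x` and `y`, are both at
`a` at some common time `≤ n`. -/
def meetProb : ℕ → α → α → ℝ≥0∞
  | 0, x, y => if x = a ∧ y = a then 1 else 0
  | n + 1, x, y => if x = a ∧ y = a then 1 else
      expect (κ x) fun x' => expect (κ y) fun y' => meetProb n x' y'

lemma meetProb_le_one (n : ℕ) (x y : α) : meetProb κ a n x y ≤ 1 := by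
  induction n generalizing x y with
  | zero => rw [meetProb]; split_ifs <;> simp
  | succ n ih =>
    rw [meetProb]
    split_ifs
    · exact le_rfl
    · exact expect_le_one _ fun _ => expect_le_one _ fun _ => ih _ _

lemma meetProb_mono (x y : α) : Monotone fun n => meetProb κ a n x y := by
  refine monotone_nat_of_le_succ fun n => ?_
  induction n generalizing x y with
  | zero => rw [meetProb, meetProb]; split_ifs <;> simp
  | succ n ih =>
    rw [meetProb, meetProb]
    split_ifs
    · exact le_rfl
    · exact expect_mono _ fun _ => expect_mono _ fun _ => ih _ _

/-- The probability that two independent copies of the chain, started at `x` and `y`, are ever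
both at `a` at the same time. -/
def meetLim (x y : α) : ℝ≥0∞ := ⨆ n, meetProb κ a n x y

lemma meetLim_le_one (x y : α) : meetLim κ a x y ≤ 1 := iSup_le fun n => meetProb_le_one κ a n x y

lemma meetLim_self : meetLim κ a a a = 1 :=
  le_antisymm (meetLim_le_one κ a a a) (le_iSup_of_le 0 (by simp [meetProb]))

/-- The meeting probability is superharmonic for the product chain. -/
lemma expect_meetLim_le (x y : α) :
    (expect (κ x) fun x' => expect (κ y) fun y' => meetLim κ a x' y') ≤ meetLim κ a x y := by
  have h : (expect (κ x) fun x' => expect (κ y) fun y' => meetLim κ a x' y') =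
      ⨆ n, expect (κ x) fun x' => expect (κ y) fun y' => meetProb κ a n x' y' := by
    rw [← expect_iSup _ fun x' m n hmn => expect_mono _ fun y' => meetProb_mono κ a x' y' hmn]
    congr 1
    funext x'
    exact expect_iSup _ fun y' => meetProb_mono κ a x' y'
  rw [h]
  refine iSup_le fun n => le_iSup_of_le (n + 1) ?_
  rw [meetProb]
  split_ifs
  · exact expect_le_one _ fun _ => expect_le_one _ fun _ => meetProb_le_one κ a _ _ _
  · exact le_rfl

lemma meetLim_eq_one_of_step {x y : α}
    (h : ∀ x' y', κ x x' ≠ 0 → κ y y' ≠ 0 → meetLim κ a x' y' = 1) : meetLim κ a x y = 1 := by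
  refine le_antisymm (meetLim_le_one κ a x y) (le_trans (le_of_eq ?_) (expect_meetLim_le κ a x y))
  have hcongr : ∀ (p : PMF α) (f : α → ℝ≥0∞), (∀ z, p z ≠ 0 → f z = 1) → expect p f = 1 := by
    intro p f hf
    rw [← expect_const p 1]
    refine tsum_congr fun z => ?_
    by_cases hz : p z = 0
    · simp [hz]
    · rw [hf z hz]
  exact (hcongr _ _ fun x' hx' => hcongr _ _ fun y' hy' => h x' y' hx' hy').symm

variable {κ a}

/-- Under a stationary law a superharmonic function is harmonic at every atom; hence the value `1`
of the meeting probability passes on to the next states. -/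
lemma meetLim_eq_one_of_stationary {μ : PMF α} (hμ : μ.bind κ = μ) {x y x' y' : α}
    (hx : μ x ≠ 0) (hy : μ y ≠ 0) (h : meetLim κ a x y = 1) (hx' : κ x x' ≠ 0) (hy' : κ y y' ≠ 0) :
    meetLim κ a x' y' = 1 := by
  set Q : α → α → ℝ≥0∞ := fun x y =>
    expect (κ x) fun x' => expect (κ y) fun y' => meetLim κ a x' y' with hQ
  have hstat : ∀ f, (expect μ fun x => expect (κ x) f) = expect μ f := fun f => by
    rw [← expect_bind, hμ]
  have hQ1 : ∀ x, expect μ (Q x) = expect (κ x) fun x' => expect μ fun y => meetLim κ a x' y := by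
    intro x
    simp only [hQ]
    rw [expect_comm]
    congr 1
    funext x'
    exact hstat _
  have hQh : (expect μ fun x => expect μ (Q x)) =
      expect μ fun x => expect μ fun y => meetLim κ a x y := by
    simp only [hQ1]
    exact hstat _
  have hle : ∀ x y, Q x y ≤ meetLim κ a x y := expect_meetLim_le κ a
  have hfin : ∀ f : α → ℝ≥0∞, (∀ z, f z ≤ 1) → expect μ f ≠ ∞ := fun f hf =>
    ((expect_le_one μ hf).trans_lt ENNReal.one_lt_top).ne
  have hx1 := eq_of_expect_eq (fun x => expect_mono μ (hle x))
    (hfin _ fun x => expect_le_one μ (meetLim_le_one κ a x)) hQh hx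
  have hxy : Q x y = meetLim κ a x y :=
    eq_of_expect_eq (hle x) (hfin _ (meetLim_le_one κ a x)) hx1 hy
  rw [h] at hxy
  have h1 := eq_one_of_expect_eq_one (fun x' => expect_le_one _ (meetLim_le_one κ a x')) hxy hx'
  exact eq_one_of_expect_eq_one (meetLim_le_one κ a x') h1 hy'

/-- For a state `a` charged by a stationary law, two copies of the chain started at states that
`a` reaches in the same number of steps meet almost surely. -/
lemma meetLim_eq_one_of_reach {μ : PMF α} (hμ : μ.bind κ = μ) (ha : μ a ≠ 0) (n : ℕ) {x y : α}
    (hx : chainLaw κ n (PMF.pure a) x ≠ 0) (hy : chainLaw κ n (PMF.pure a) y ≠ 0) :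
    meetLim κ a x y = 1 := by
  have key : ∀ n, (∀ x, chainLaw κ n (PMF.pure a) x ≠ 0 → μ x ≠ 0) ∧
      ∀ x y, chainLaw κ n (PMF.pure a) x ≠ 0 → chainLaw κ n (PMF.pure a) y ≠ 0 →
        meetLim κ a x y = 1 := by
    intro n
    induction n with
    | zero =>
      have h0 : ∀ x, chainLaw κ 0 (PMF.pure a) x ≠ 0 → x = a := fun x hx => by
        simpa [chainLaw, PMF.pure_apply] using hx
      refine ⟨fun x hx => h0 x hx ▸ ha, fun x y hx hy => ?_⟩
      rw [h0 x hx, h0 y hy, meetLim_self]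
    | succ n ih =>
      have hs : ∀ x, chainLaw κ (n + 1) (PMF.pure a) x ≠ 0 →
          ∃ z, chainLaw κ n (PMF.pure a) z ≠ 0 ∧ κ z x ≠ 0 := fun x hx => by
        rw [chainLaw_succ] at hx
        simpa only [PMF.bind_apply, ne_eq, ENNReal.tsum_eq_zero, not_forall, mul_eq_zero,
          not_or] using hx
      refine ⟨fun x hx => ?_, fun x y hx hy => ?_⟩
      · obtain ⟨z, hz, hzx⟩ := hs x hx
        exact apply_ne_zero_of_stationary hμ (ih.1 z hz) hzx
      · obtain ⟨z, hz, hzx⟩ := hs x hx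
        obtain ⟨w, hw, hwy⟩ := hs y hy
        exact meetLim_eq_one_of_stationary hμ (ih.1 z hz) (ih.1 w hw) (ih.2 z w hz hw) hzx hwy
  exact (key n).2 x y hx hy

/-- The coupling inequality: the laws of the two copies differ only as far as these have not
met. -/
lemma expect_chainLaw_add_meetProb_le (n : ℕ) (x y : α) {f : α → ℝ≥0∞} (hf : ∀ z, f z ≤ 1) :
    expect (chainLaw κ n (PMF.pure x)) f + meetProb κ a n x y ≤
      expect (chainLaw κ n (PMF.pure y)) f + 1 := by
  by_cases hxy : x = a ∧ y = a
  · rw [hxy.1, hxy.2]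
    exact add_le_add_right (meetProb_le_one κ a n a a) _
  · induction n generalizing x y with
    | zero =>
      rw [meetProb, if_neg hxy, add_zero]
      exact (expect_le_one _ hf).trans le_add_self
    | succ n ih =>
      have ih' : ∀ x y, expect (chainLaw κ n (PMF.pure x)) f + meetProb κ a n x y ≤
          expect (chainLaw κ n (PMF.pure y)) f + 1 := fun x y => by
        by_cases h : x = a ∧ y = a
        · rw [h.1, h.2]
          exact add_le_add_right (meetProb_le_one κ a n a a) _
        · exact ih x y h
      rw [meetProb, if_neg hxy, chainLaw_succ_pure, chainLaw_succ_pure, expect_bind, expect_bind,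
        ← expect_add]
      refine (expect_mono _ (g := fun _ => (expect (κ y) fun y' =>
        expect (chainLaw κ n (PMF.pure y')) f) + 1) fun x' => ?_).trans_eq (expect_const _ _)
      calc _ = expect (κ y) fun y' => expect (chainLaw κ n (PMF.pure x')) f +
              meetProb κ a n x' y' := by rw [expect_add, expect_const]
        _ ≤ expect (κ y) fun y' => expect (chainLaw κ n (PMF.pure y')) f + 1 :=
              expect_mono _ fun y' => ih' x' y'
        _ = _ := by rw [expect_add, expect_const]

/-- If two copies of a chain meet at `a` almost surely, from every pair of initial states, then the
chain converges to a given stationary law. -/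
theorem tendsto_expect_chainLaw {μ : PMF α} (hμ : μ.bind κ = μ)
    (hmeet : ∀ x y, meetLim κ a x y = 1) (x : α) {f : α → ℝ≥0∞} (hf : ∀ z, f z ≤ 1) :
    Tendsto (fun n => expect (chainLaw κ n (PMF.pure x)) f) atTop (𝓝 (expect μ f)) := by
  have hlaw : ∀ n, expect μ f = expect μ fun y => expect (chainLaw κ n (PMF.pure y)) f := fun n => by
    rw [← expect_bind, ← chainLaw_eq_bind, chainLaw_of_stationary κ hμ]
  have hfin : expect μ f ≠ ∞ := ((expect_le_one μ hf).trans_lt ENNReal.one_lt_top).ne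
  have hlim : ∀ g : ℕ → α → ℝ≥0∞, (∀ y, Monotone fun n => g n y) → (∀ y, ⨆ n, g n y = 1) →
      Tendsto (fun n => expect μ (g n)) atTop (𝓝 1) := fun g hg hg1 => by
    have h := tendsto_atTop_iSup (f := fun n => expect μ (g n))
      (fun m n hmn => expect_mono μ fun y => hg y hmn)
    rwa [← expect_iSup μ hg, funext hg1, expect_const] at h
  have h1 := hlim (fun n y => meetProb κ a n x y) (fun y => meetProb_mono κ a x y) (hmeet x)
  have h2 := hlim (fun n y => meetProb κ a n y x) (fun y => meetProb_mono κ a y x)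
    (fun y => hmeet y x)
  have hU : Tendsto (fun n => expect μ f + 1 - expect μ fun y => meetProb κ a n x y) atTop
      (𝓝 (expect μ f)) := by
    have := ENNReal.Tendsto.sub (tendsto_const_nhds (x := expect μ f + 1)) h1
      (Or.inr ENNReal.one_ne_top)
    rwa [ENNReal.add_sub_cancel_right ENNReal.one_ne_top] at this
  have hL : Tendsto (fun n => (expect μ f + expect μ fun y => meetProb κ a n y x) - 1) atTop
      (𝓝 (expect μ f)) := by
    have := ENNReal.Tendsto.sub (h2.const_add (expect μ f)) (tendsto_const_nhds (x := (1 : ℝ≥0∞)))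
      (Or.inr ENNReal.one_ne_top)
    rwa [ENNReal.add_sub_cancel_right ENNReal.one_ne_top] at this
  refine tendsto_of_tendsto_of_tendsto_of_le_of_le hL hU (fun n => ?_) (fun n => ?_)
  · rw [tsub_le_iff_right]
    calc _ = expect μ fun y => expect (chainLaw κ n (PMF.pure y)) f + meetProb κ a n y x := by
          rw [expect_add, ← hlaw]
      _ ≤ expect μ fun _ => expect (chainLaw κ n (PMF.pure x)) f + 1 :=
          expect_mono μ fun y => expect_chainLaw_add_meetProb_le n y x hf
      _ = _ := expect_const _ _
  · refine ENNReal.le_sub_of_add_le_right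
      ((expect_le_one μ fun y => meetProb_le_one κ a n x y).trans_lt ENNReal.one_lt_top).ne ?_
    calc _ = expect μ fun y => expect (chainLaw κ n (PMF.pure x)) f + meetProb κ a n x y := by
          rw [expect_add, expect_const]
      _ ≤ expect μ fun y => expect (chainLaw κ n (PMF.pure y)) f + 1 :=
          expect_mono μ fun y => expect_chainLaw_add_meetProb_le n x y hf
      _ = _ := by rw [expect_add, expect_const, ← hlaw]

/-- The coupling inequality for two copies with stationary initial laws. -/
lemma expect_le_of_stationary {μ ν : PMF α} (hμ : μ.bind κ = μ) (hν : ν.bind κ = ν)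
    (hmeet : ∀ x y, meetLim κ a x y = 1) {f : α → ℝ≥0∞} (hf : ∀ z, f z ≤ 1) :
    expect ν f ≤ expect μ f := by
  have hlaw : ∀ {p : PMF α}, p.bind κ = p → ∀ n,
      expect p f = expect p fun y => expect (chainLaw κ n (PMF.pure y)) f := fun hp n => by
    rw [← expect_bind, ← chainLaw_eq_bind, chainLaw_of_stationary κ hp]
  have hn : ∀ n, expect ν f + (expect ν fun x => expect μ fun y => meetProb κ a n x y) ≤
      expect μ f + 1 := fun n => by
    calc _ = expect ν fun x => expect μ fun y =>
            expect (chainLaw κ n (PMF.pure x)) f + meetProb κ a n x y := by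
          simp only [expect_add, expect_const]
          rw [← hlaw hν]
      _ ≤ expect ν fun _ => expect μ fun y => expect (chainLaw κ n (PMF.pure y)) f + 1 :=
          expect_mono _ fun x => expect_mono _ fun y => expect_chainLaw_add_meetProb_le n x y hf
      _ = _ := by rw [expect_const, expect_add, expect_const, ← hlaw hμ]
  have hone : ⨆ n, (expect ν fun x => expect μ fun y => meetProb κ a n x y) = 1 := by
    rw [← expect_iSup ν fun x m n hmn => expect_mono μ fun y => meetProb_mono κ a x y hmn]
    simp only [← expect_iSup μ fun y => meetProb_mono κ a _ y]
    calc _ = expect ν fun x => expect μ fun y => meetLim κ a x y := rfl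
      _ = 1 := by simp only [hmeet, expect_const]
  have h := iSup_le hn
  rw [← ENNReal.add_iSup, hone] at h
  exact (ENNReal.add_le_add_iff_right ENNReal.one_ne_top).mp h

/-- If two copies of a chain meet at `a` almost surely, from every pair of initial states, then the
chain has at most one stationary law. -/
theorem eq_of_stationary {μ ν : PMF α} (hμ : μ.bind κ = μ) (hν : ν.bind κ = ν)
    (hmeet : ∀ x y, meetLim κ a x y = 1) : ν = μ := by
  ext x
  rw [← expect_ite_eq ν, ← expect_ite_eq μ]
  have hf : ∀ z, (if z = x then (1 : ℝ≥0∞) else 0) ≤ 1 := fun z => by split_ifs <;> simp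
  exact le_antisymm (expect_le_of_stationary hμ hν hmeet hf)
    (expect_le_of_stationary hν hμ hmeet hf)

end MarkovChain

/-! ### The stationary law of the queue -/

lemma serviceTime_apply (θ : ℝ≥0) (k : ℕ) :
    serviceTime θ k = ENNReal.ofReal (poissonWeight θ k) := by
  rw [serviceTime, Measure.toPMF_apply, poissonMeasure_singleton, poissonWeight]
  congr 1; ring

lemma serviceTime_ne_zero {θ : ℝ≥0} (h0 : 0 < θ) (k : ℕ) : serviceTime θ k ≠ 0 := by
  rw [serviceTime_apply, ne_eq, ENNReal.ofReal_eq_zero, not_le]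
  exact poissonWeight_pos (by exact_mod_cast h0) k

lemma expect_startService_zero (θ : ℝ≥0) (f : State → ℝ≥0∞) :
    expect (startService θ 0) f = f (0, 0) := by
  rw [startService, expect_pure]

lemma expect_startService_succ (θ : ℝ≥0) (q : ℕ) (f : State → ℝ≥0∞) :
    expect (startService θ (q + 1)) f = serviceTime θ 0 * expect (startService θ q) f +
      ∑' k, serviceTime θ (k + 1) * f (q + 1, k + 1) := by
  rw [startService, expect_bind, expect, tsum_eq_zero_add' ENNReal.summable]
  simp [expect_pure]

/-- The mean service time is `θ`. -/
lemma tsum_serviceTime_mul_natCast (θ : ℝ≥0) :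
    ∑' k : ℕ, serviceTime θ k * (k : ℝ≥0∞) = ENNReal.ofReal θ := by
  rw [tsum_eq_zero_add' ENNReal.summable, Nat.cast_zero, mul_zero, zero_add]
  have h : ∀ k : ℕ, serviceTime θ (k + 1) * ((k + 1 : ℕ) : ℝ≥0∞) =
      ENNReal.ofReal θ * serviceTime θ k := fun k => by
    rw [serviceTime_apply, serviceTime_apply, ← ENNReal.ofReal_natCast,
      ← ENNReal.ofReal_mul (poissonWeight_nonneg θ.coe_nonneg _), ← ENNReal.ofReal_mul θ.coe_nonneg]
    congr 1
    rw [poissonWeight, poissonWeight, Nat.factorial_succ]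
    push_cast
    field_simp
    exact pow_succ' _ _
  simp only [h, ENNReal.tsum_mul_left, PMF.tsum_coe, mul_one]

/-- The mean of `w` at the queue length after a service, with the overflow collected at `K`. -/
lemma hasSum_poissonWeight_mul_min (θ : ℝ) (w : ℕ → ℝ) {i K : ℕ} :
    HasSum (fun k => poissonWeight θ k * w (min (i + k) K))
      (∑ k ∈ Finset.range (K - i), poissonWeight θ k * w (i + k) +
        (1 - ∑ k ∈ Finset.range (K - i), poissonWeight θ k) * w K) := by
  have h : HasSum (fun k => poissonWeight θ (k + (K - i)) * w (min (i + (k + (K - i))) K))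
      ((1 - ∑ k ∈ Finset.range (K - i), poissonWeight θ k) * w K) := by
    refine HasSum.congr_fun
      (((hasSum_nat_add_iff' (K - i)).mpr (hasSum_poissonWeight θ)).mul_right (w K)) fun k => ?_
    rw [min_eq_right (by omega)]
  have h2 := (hasSum_nat_add_iff (f := fun k => poissonWeight θ k * w (min (i + k) K))
    (K - i)).mp h
  have h3 : ∑ k ∈ Finset.range (K - i), poissonWeight θ k * w (i + k) =
      ∑ k ∈ Finset.range (K - i), poissonWeight θ k * w (min (i + k) K) :=
    Finset.sum_congr rfl fun k hk => by
      have := Finset.mem_range.mp hk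
      rw [min_eq_left (by omega)]
  rw [add_comm, h3]
  exact h2

/-- The relation `sum_serviceRate_balance` for extended nonnegative functions. -/
lemma sum_serviceRate_balance_ennreal {θ : ℝ≥0} (h0 : 0 < θ) (h1 : θ < 1) (K : ℕ)
    {w : ℕ → ℝ≥0∞} (hw : ∀ i, w i ≤ 1) :
    ENNReal.ofReal (queueCdf θ 0) * w 1 + ∑ i ∈ Finset.range (K + 1),
      ENNReal.ofReal (serviceRate θ i) * ∑' k, serviceTime θ k * w (min (i + k) (K + 1)) =
    ENNReal.ofReal (queueCdf θ 0) * w 0 + ∑ i ∈ Finset.range (K + 1),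
      ENNReal.ofReal (serviceRate θ i) * w (i + 1) := by
  have h0' : (0 : ℝ) < θ := by exact_mod_cast h0
  have h1' : (θ : ℝ) < 1 := by exact_mod_cast h1
  have hF := (queueCdf_pos_and_le_succ h0' h1' 0).1.le
  have hr := serviceRate_nonneg h0' h1'
  obtain ⟨v, hv0, rfl⟩ : ∃ v : ℕ → ℝ, (∀ i, 0 ≤ v i) ∧ w = fun i => ENNReal.ofReal (v i) :=
    ⟨fun i => (w i).toReal, fun i => ENNReal.toReal_nonneg, funext fun i =>
      (ENNReal.ofReal_toReal ((hw i).trans_lt ENNReal.one_lt_top).ne).symm⟩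
  have hs : ∀ i, ∑' k, serviceTime θ k * ENNReal.ofReal (v (min (i + k) (K + 1))) =
      ENNReal.ofReal (∑ k ∈ Finset.range (K + 1 - i), poissonWeight θ k * v (i + k) +
        (1 - ∑ k ∈ Finset.range (K + 1 - i), poissonWeight θ k) * v (K + 1)) := fun i => by
    have h := hasSum_poissonWeight_mul_min θ v (i := i) (K := K + 1)
    rw [← h.tsum_eq, ENNReal.ofReal_tsum_of_nonneg
      (fun k => mul_nonneg (poissonWeight_nonneg h0'.le k) (hv0 _)) h.summable]
    refine tsum_congr fun k => ?_
    rw [serviceTime_apply, ENNReal.ofReal_mul (poissonWeight_nonneg h0'.le k)]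
  have hs0 : ∀ i, 0 ≤ ∑ k ∈ Finset.range (K + 1 - i), poissonWeight θ k * v (i + k) +
        (1 - ∑ k ∈ Finset.range (K + 1 - i), poissonWeight θ k) * v (K + 1) := fun i => by
    rw [← (hasSum_poissonWeight_mul_min θ v).tsum_eq]
    exact tsum_nonneg fun k => mul_nonneg (poissonWeight_nonneg h0'.le k) (hv0 _)
  simp only [hs]
  simp only [← ENNReal.ofReal_mul hF, ← ENNReal.ofReal_mul (hr _)]
  rw [← ENNReal.ofReal_sum_of_nonneg fun i _ => mul_nonneg (hr i) (hs0 i),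
    ← ENNReal.ofReal_sum_of_nonneg fun i _ => mul_nonneg (hr i) (hv0 _),
    ← ENNReal.ofReal_add (mul_nonneg hF (hv0 _))
      (Finset.sum_nonneg fun i _ => mul_nonneg (hr i) (hs0 i)),
    ← ENNReal.ofReal_add (mul_nonneg hF (hv0 _))
      (Finset.sum_nonneg fun i _ => mul_nonneg (hr i) (hv0 _)),
    sum_serviceRate_balance h0' h1' v K]

/-- The stationary law before normalization. The atom at `(0, 0)` is the idle time. A service that
begins with `i + 1` packets and lasts `k` blocks spends its block `s < k` in the state
`(min (i + 1 + s) K, k - s)`, and these visits are summed with the rate of such services. -/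
def occupation (θ : ℝ≥0) (K : ℕ) : Measure State :=
  ENNReal.ofReal (queueCdf θ 0) • Measure.dirac (0, 0) +
    ∑ i ∈ Finset.range K, ENNReal.ofReal (serviceRate θ i) •
      Measure.sum fun k => serviceTime θ k •
        ∑ s ∈ Finset.range k, Measure.dirac (min (i + 1 + s) K, k - s)

lemma lintegral_occupation (θ : ℝ≥0) (K : ℕ) (f : State → ℝ≥0∞) :
    ∫⁻ x, f x ∂(occupation θ K) = ENNReal.ofReal (queueCdf θ 0) * f (0, 0) +
      ∑ i ∈ Finset.range K, ENNReal.ofReal (serviceRate θ i) *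
        ∑' k, serviceTime θ k * ∑ s ∈ Finset.range k, f (min (i + 1 + s) K, k - s) := by
  simp only [occupation, lintegral_add_measure, lintegral_finsetSum_measure,
    lintegral_smul_measure, lintegral_sum_measure, lintegral_dirac, smul_eq_mul]

/-- The total mass of `occupation`: idle time plus `θ` for each service. -/
def cycleLength (θ : ℝ) (K : ℕ) : ℝ := queueCdf θ 0 + θ * serviceCdf θ K

lemma cycleLength_pos {θ : ℝ} (h0 : 0 < θ) (h1 : θ < 1) (K : ℕ) : 0 < cycleLength θ K := by
  have h := queueCdf_pos_and_le_succ h0 h1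
  have : 0 ≤ serviceCdf θ K := by
    rcases K with _ | K
    · exact le_rfl
    · exact (h (K + 1)).1.le
  have := (h 0).1
  unfold cycleLength; positivity

lemma cycleLength_succ {θ : ℝ} (h0 : 0 < θ) (h1 : θ < 1) (K : ℕ) :
    cycleLength θ (K + 1) = 1 - θ * varphi θ (K + 1 : ℕ) := by
  rw [cycleLength, serviceCdf, queueCdf_zero h0 h1, varphi_eq]; ring

lemma occupation_univ {θ : ℝ≥0} (h0 : 0 < θ) (h1 : θ < 1) (K : ℕ) :
    occupation θ K Set.univ = ENNReal.ofReal (cycleLength θ K) := by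
  have h0' : (0 : ℝ) < θ := by exact_mod_cast h0
  have h1' : (θ : ℝ) < 1 := by exact_mod_cast h1
  have hr := serviceRate_nonneg h0' h1'
  rw [← lintegral_one, lintegral_occupation]
  simp only [Finset.sum_const, Finset.card_range, nsmul_eq_mul, mul_one,
    tsum_serviceTime_mul_natCast]
  rw [← Finset.sum_mul, ← ENNReal.ofReal_sum_of_nonneg fun i _ => hr i,
    ← ENNReal.ofReal_mul (Finset.sum_nonneg fun i _ => hr i),
    ← ENNReal.ofReal_add (queueCdf_pos_and_le_succ h0' h1' 0).1.le
      (mul_nonneg (Finset.sum_nonneg fun i _ => hr i) h0'.le),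
    sum_serviceRate, cycleLength, mul_comm]

lemma isProbabilityMeasure_occupation {θ : ℝ≥0} (h0 : 0 < θ) (h1 : θ < 1) (K : ℕ) :
    IsProbabilityMeasure ((ENNReal.ofReal (cycleLength θ K))⁻¹ • occupation θ K) := by
  constructor
  rw [Measure.smul_apply, occupation_univ h0 h1, smul_eq_mul]
  refine ENNReal.inv_mul_cancel ?_ ENNReal.ofReal_ne_top
  rw [ne_eq, ENNReal.ofReal_eq_zero, not_le]
  exact cycleLength_pos (by exact_mod_cast h0) (by exact_mod_cast h1) K

/-- The stationary law of the queue. -/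
def queueLaw {θ : ℝ≥0} (h0 : 0 < θ) (h1 : θ < 1) (K : ℕ) : PMF State :=
  haveI := isProbabilityMeasure_occupation h0 h1 K
  ((ENNReal.ofReal (cycleLength θ K))⁻¹ • occupation θ K).toPMF

lemma expect_queueLaw {θ : ℝ≥0} (h0 : 0 < θ) (h1 : θ < 1) (K : ℕ) (f : State → ℝ≥0∞) :
    expect (queueLaw h0 h1 K) f =
      (ENNReal.ofReal (cycleLength θ K))⁻¹ * ∫⁻ x, f x ∂(occupation θ K) := by
  rw [← smul_eq_mul, ← lintegral_smul_measure, lintegral_countable', expect]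
  refine tsum_congr fun x => ?_
  rw [mul_comm]; rfl

/-- The measure `occupation` is invariant. One block moves each service to its next block; the
remaining terms, the ends and the beginnings of services, balance by
`sum_serviceRate_balance_ennreal`. -/
lemma lintegral_occupation_blockStep {θ : ℝ≥0} (h0 : 0 < θ) (h1 : θ < 1) (K : ℕ)
    {f : State → ℝ≥0∞} (hf : ∀ x, f x ≤ 1) :
    ∫⁻ x, expect (blockStep θ K x) f ∂(occupation θ K) = ∫⁻ x, f x ∂(occupation θ K) := by
  rw [lintegral_occupation, lintegral_occupation]
  rcases K with _ | K
  · simp [blockStep, expect_startService_zero]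
  set σ : ℕ → ℝ≥0∞ := fun i => expect (startService θ i) f with hσ
  have hσ1 : ∀ i, σ i ≤ 1 := fun i => expect_le_one _ hf
  -- `C i` is the part of a service after its first block, which both sides share. Adding the
  -- services of length `0` to both sides completes the sums over the service time.
  set C : ℕ → ℝ≥0∞ := fun i => ∑' k, serviceTime θ (k + 1) *
    ∑ s ∈ Finset.range k, f (min (i + 2 + s) (K + 1), k - s) with hC
  have hidle : expect (blockStep θ (K + 1) (0, 0)) f = σ 1 := by
    simp [blockStep, hσ]
  have hL : ∀ i ∈ Finset.range (K + 1), (∑' k, serviceTime θ k * ∑ s ∈ Finset.range k,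
      expect (blockStep θ (K + 1) (min (i + 1 + s) (K + 1), k - s)) f) + serviceTime θ 0 * σ i =
      C i + ∑' k, serviceTime θ k * σ (min (i + k) (K + 1)) := by
    intro i hi
    have hi' := Finset.mem_range.mp hi
    rw [tsum_eq_zero_add' (f := fun k => serviceTime θ k * σ (min (i + k) (K + 1)))
      ENNReal.summable, tsum_eq_zero_add' ENNReal.summable]
    simp only [Finset.range_zero, Finset.sum_empty, mul_zero, zero_add, add_zero]
    rw [min_eq_left (by omega : i ≤ K + 1), add_comm (serviceTime θ 0 * σ i), ← add_assoc, hC,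
      ← ENNReal.tsum_add]
    congr 1
    refine tsum_congr fun k => ?_
    rw [← mul_add, Finset.sum_range_succ]
    congr 2
    · refine Finset.sum_congr rfl fun s hs => ?_
      have hs' := Finset.mem_range.mp hs
      obtain ⟨m, hm⟩ : ∃ m, min (i + 1 + s) (K + 1) = m + 1 := ⟨min (i + s) K, by omega⟩
      rw [show k + 1 - s = (k - s - 1) + 2 by omega, hm, blockStep, expect_pure]
      congr 2 <;> omega
    · obtain ⟨m, hm⟩ : ∃ m, min (i + 1 + k) (K + 1) = m + 1 := ⟨min (i + k) K, by omega⟩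
      rw [show k + 1 - k = 1 by omega, hm]
      simp only [blockStep, hσ]
      congr 2; omega
  have hR : ∀ i ∈ Finset.range (K + 1), (∑' k, serviceTime θ k * ∑ s ∈ Finset.range k,
      f (min (i + 1 + s) (K + 1), k - s)) + serviceTime θ 0 * σ i = C i + σ (i + 1) := by
    intro i hi
    have hi' := Finset.mem_range.mp hi
    rw [tsum_eq_zero_add' ENNReal.summable]
    simp only [Finset.range_zero, Finset.sum_empty, mul_zero, zero_add]
    simp only [hσ]
    rw [expect_startService_succ, add_comm (serviceTime θ 0 * _), ← add_assoc, hC,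
      ← ENNReal.tsum_add]
    congr 1
    refine tsum_congr fun k => ?_
    rw [← mul_add, Finset.sum_range_succ']
    congr 2
    · refine Finset.sum_congr rfl fun s hs => ?_
      congr 2 <;> omega
    · congr 2; omega
  have hfin : ∑ i ∈ Finset.range (K + 1), ENNReal.ofReal (serviceRate θ i) *
      (serviceTime θ 0 * σ i) ≠ ∞ := by
    refine ENNReal.sum_ne_top.mpr fun i _ => ENNReal.mul_ne_top ENNReal.ofReal_ne_top ?_
    exact ENNReal.mul_ne_top ((serviceTime θ).apply_ne_top 0)
      ((hσ1 i).trans_lt ENNReal.one_lt_top).ne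
  have hbal := sum_serviceRate_balance_ennreal h0 h1 K hσ1
  refine (ENNReal.add_left_inj hfin).mp ?_
  rw [add_assoc, add_assoc, ← Finset.sum_add_distrib, ← Finset.sum_add_distrib]
  simp only [← mul_add]
  rw [Finset.sum_congr rfl fun i hi => congrArg (ENNReal.ofReal (serviceRate θ i) * ·) (hL i hi),
    Finset.sum_congr rfl fun i hi => congrArg (ENNReal.ofReal (serviceRate θ i) * ·) (hR i hi)]
  simp only [mul_add, Finset.sum_add_distrib]
  rw [hidle, add_left_comm, hbal, ← expect_startService_zero θ f]
  ring

theorem queueLaw_bind_blockStep {θ : ℝ≥0} (h0 : 0 < θ) (h1 : θ < 1) (K : ℕ) :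
    (queueLaw h0 h1 K).bind (blockStep θ K) = queueLaw h0 h1 K := by
  ext x
  rw [← expect_ite_eq _ x, ← expect_ite_eq (queueLaw h0 h1 K) x, expect_bind, expect_queueLaw,
    expect_queueLaw, lintegral_occupation_blockStep h0 h1 K fun z => ?_]
  split_ifs <;> simp

lemma queueLaw_zero_ne_zero {θ : ℝ≥0} (h0 : 0 < θ) (h1 : θ < 1) (K : ℕ) :
    queueLaw h0 h1 K (0, 0) ≠ 0 := by
  rw [← expect_ite_eq _ ((0, 0) : State), expect_queueLaw, lintegral_occupation, if_pos rfl]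
  refine mul_ne_zero (ENNReal.inv_ne_zero.mpr ENNReal.ofReal_ne_top) ?_
  have := (queueCdf_pos_and_le_succ (θ := θ) (by exact_mod_cast h0) (by exact_mod_cast h1) 0).1
  simp [this]

/-! ### The queue-length marginal -/

lemma queueProb_eq (μ : PMF State) (j : ℕ) :
    queueProb μ j = (expect μ fun x => if x.1 = j then 1 else 0).toReal := by
  rw [queueProb, PMF.map_apply, expect]
  congr 1
  refine tsum_congr fun x => ?_
  simp [eq_comm]

lemma tsum_serviceTime_ite_lt (θ : ℝ≥0) (m : ℕ) :
    (∑' k, serviceTime θ k * if m < k then 1 else 0) =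
      ENNReal.ofReal (1 - ∑ k ∈ Finset.range (m + 1), poissonWeight θ k) := by
  have h := hasSum_poissonWeight_mul_min θ (fun n => if n = m + 1 then 1 else 0) (i := 0)
    (K := m + 1)
  have h0 : ∑ k ∈ Finset.range (m + 1), poissonWeight θ k *
      (if 0 + k = m + 1 then (1 : ℝ) else 0) = 0 := Finset.sum_eq_zero fun k hk => by
    have := Finset.mem_range.mp hk
    rw [if_neg (by omega), mul_zero]
  rw [Nat.sub_zero, if_pos rfl, mul_one, h0, zero_add] at h
  rw [← h.tsum_eq, ENNReal.ofReal_tsum_of_nonneg _ h.summable]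
  · refine tsum_congr fun k => ?_
    rw [serviceTime_apply]
    by_cases hk : m < k
    · rw [if_pos hk, if_pos (by omega), mul_one, mul_one]
    · rw [if_neg hk, if_neg (by omega), mul_zero, mul_zero, ENNReal.ofReal_zero]
  · intro k
    refine mul_nonneg (poissonWeight_nonneg θ.coe_nonneg k) ?_
    split_ifs <;> simp

lemma lintegral_occupation_length_zero (θ : ℝ≥0) (K : ℕ) :
    (∫⁻ x, (if x.1 = 0 then 1 else 0) ∂(occupation θ K)) = ENNReal.ofReal (queueCdf θ 0) := by
  rw [lintegral_occupation]
  have : ∀ i ∈ Finset.range K, ENNReal.ofReal (serviceRate θ i) * ∑' k, serviceTime θ k *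
      ∑ s ∈ Finset.range k, (if min (i + 1 + s) K = 0 then (1 : ℝ≥0∞) else 0) = 0 := by
    intro i hi
    have := Finset.mem_range.mp hi
    have h : ∀ s, ¬ min (i + 1 + s) K = 0 := fun s => by omega
    simp [h]
  rw [Finset.sum_congr rfl this]
  simp

lemma lintegral_occupation_length_succ {θ : ℝ≥0} (h0 : 0 < θ) (h1 : θ < 1) {K q : ℕ}
    (hq : q + 1 < K) :
    (∫⁻ x, (if x.1 = q + 1 then 1 else 0) ∂(occupation θ K)) =
      ENNReal.ofReal (queueCdf θ (q + 1) - queueCdf θ q) := by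
  have h0' : (0 : ℝ) < θ := by exact_mod_cast h0
  have h1' : (θ : ℝ) < 1 := by exact_mod_cast h1
  have hr := serviceRate_nonneg h0' h1'
  rw [lintegral_occupation, if_neg (by simp), mul_zero, zero_add,
    ← sum_serviceRate_mul_tail h0' h1', ENNReal.ofReal_sum_of_nonneg]
  · rw [← Finset.sum_subset (Finset.range_subset_range.mpr hq.le)]
    · refine Finset.sum_congr rfl fun i hi => ?_
      have hi' := Finset.mem_range.mp hi
      rw [ENNReal.ofReal_mul (hr i), show q + 1 - i = (q - i) + 1 by omega,
        ← tsum_serviceTime_ite_lt]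
      congr 1
      refine tsum_congr fun k => ?_
      congr 1
      have : ∀ s, (min (i + 1 + s) K = q + 1) ↔ q - i = s := fun s => by omega
      simp [this, Finset.sum_ite_eq]
    · intro i hi hi'
      have := mt Finset.mem_range.mpr hi'
      have := Finset.mem_range.mp hi
      have h : ∀ s, ¬ min (i + 1 + s) K = q + 1 := fun s => by omega
      simp [h]
  · intro i _
    refine mul_nonneg (hr i) (sub_nonneg.mpr ?_)
    exact sum_le_hasSum _ (fun m _ => poissonWeight_nonneg h0'.le m) (hasSum_poissonWeight θ)

lemma sum_queueProb_queueLaw {θ : ℝ≥0} (h0 : 0 < θ) (h1 : θ < 1) (K : ℕ) :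
    ∑ j ∈ Finset.range (K + 1), queueProb (queueLaw h0 h1 K) j = 1 := by
  have hone : (expect (queueLaw h0 h1 K) fun x => if x.1 ≤ K then 1 else 0) = 1 := by
    refine Eq.trans ?_ (expect_const (queueLaw h0 h1 K) 1)
    rw [expect_queueLaw, expect_queueLaw, lintegral_occupation, lintegral_occupation]
    simp
  simp only [queueProb_eq]
  rw [← ENNReal.toReal_sum, ← ENNReal.toReal_one]
  · refine congrArg _ (Eq.trans ?_ hone)
    simp only [expect]
    rw [← Summable.tsum_finsetSum fun _ _ => ENNReal.summable]
    refine tsum_congr fun x => ?_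
    rw [← Finset.mul_sum, Finset.sum_ite_eq]
    simp
  · intro j _
    refine ((expect_le_one _ fun x => ?_).trans_lt ENNReal.one_lt_top).ne
    split_ifs <;> simp

/-! ### Any two copies of the queue meet -/

lemma bind_apply_ne_zero_iff {α β : Type*} {p : PMF α} {κ : α → PMF β} {y : β} :
    p.bind κ y ≠ 0 ↔ ∃ x, p x ≠ 0 ∧ κ x y ≠ 0 := by
  simp only [← PMF.mem_support_iff, PMF.mem_support_bind_iff]

lemma pure_apply_ne_zero_iff {α : Type*} {a y : α} : PMF.pure a y ≠ 0 ↔ y = a := by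
  rw [← PMF.mem_support_iff, PMF.support_pure, Set.mem_singleton_iff]

lemma startService_apply_zero_ne_zero {θ : ℝ≥0} (h0 : 0 < θ) (q : ℕ) :
    startService θ q (0, 0) ≠ 0 := by
  induction q with
  | zero => rw [startService, pure_apply_ne_zero_iff]
  | succ q ih =>
    rw [startService, bind_apply_ne_zero_iff]
    exact ⟨0, serviceTime_ne_zero h0 0, by rwa [if_pos rfl]⟩

lemma startService_succ_apply_ne_zero {θ : ℝ≥0} (h0 : 0 < θ) (q k : ℕ) :
    startService θ (q + 1) (q + 1, k + 1) ≠ 0 := by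
  rw [startService, bind_apply_ne_zero_iff]
  exact ⟨k + 1, serviceTime_ne_zero h0 _, by
    rw [if_neg (by omega), pure_apply_ne_zero_iff]⟩

lemma of_startService_apply_ne_zero {θ : ℝ≥0} {q : ℕ} {y : State} (h : startService θ q y ≠ 0) :
    y = (0, 0) ∨ (1 ≤ y.1 ∧ y.1 ≤ q ∧ 1 ≤ y.2) := by
  induction q with
  | zero => rw [startService, pure_apply_ne_zero_iff] at h; exact Or.inl h
  | succ q ih =>
    rw [startService, bind_apply_ne_zero_iff] at h
    obtain ⟨k, -, hk⟩ := h
    split_ifs at hk with hk0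
    · exact (ih hk).imp_right fun h => ⟨h.1, by omega, h.2.2⟩
    · rw [pure_apply_ne_zero_iff] at hk
      subst hk
      exact Or.inr ⟨by simp, le_rfl, by simp; omega⟩

lemma of_blockStep_apply_ne_zero {θ : ℝ≥0} {K : ℕ} {x y : State}
    (h : blockStep θ (K + 1) x y ≠ 0) :
    y = (0, 0) ∨ (1 ≤ y.1 ∧ y.1 ≤ K + 1 ∧ 1 ≤ y.2) := by
  rcases x with ⟨_ | q, _ | _ | r⟩ <;> simp only [blockStep] at h
  · exact (of_startService_apply_ne_zero h).imp_right fun h => ⟨h.1, by omega, h.2.2⟩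
  · exact (of_startService_apply_ne_zero h).imp_right fun h => ⟨h.1, by omega, h.2.2⟩
  · exact (of_startService_apply_ne_zero h).imp_right fun h => ⟨h.1, by omega, h.2.2⟩
  · exact (of_startService_apply_ne_zero h).imp_right fun h => ⟨h.1, by omega, h.2.2⟩
  · exact (of_startService_apply_ne_zero h).imp_right fun h => ⟨h.1, by omega, h.2.2⟩
  · rw [pure_apply_ne_zero_iff] at h
    subst h
    exact Or.inr ⟨by simp, by simp, by simp⟩

lemma chainLaw_blockStep_zero_ne_zero {θ : ℝ≥0} (h0 : 0 < θ) (K n : ℕ) :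
    chainLaw (blockStep θ K) n (PMF.pure (0, 0)) (0, 0) ≠ 0 := by
  induction n with
  | zero => exact pure_apply_ne_zero_iff.mpr rfl
  | succ n ih =>
    rw [chainLaw_succ, bind_apply_ne_zero_iff]
    exact ⟨_, ih, startService_apply_zero_ne_zero h0 _⟩

/-- From the empty queue, the state `(q + 1, r + 1)` is reached after idling for `n` blocks, by a
service of length `q + r + 1`. -/
lemma chainLaw_blockStep_ne_zero {θ : ℝ≥0} (h0 : 0 < θ) {K q : ℕ} (hq : q ≤ K) (n r : ℕ) :
    chainLaw (blockStep θ (K + 1)) (n + q + 1) (PMF.pure (0, 0)) (q + 1, r + 1) ≠ 0 := by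
  induction q generalizing r with
  | zero =>
    rw [chainLaw_succ, bind_apply_ne_zero_iff]
    refine ⟨(0, 0), chainLaw_blockStep_zero_ne_zero h0 _ _, ?_⟩
    rw [blockStep, min_eq_left (by omega)]
    exact startService_succ_apply_ne_zero h0 0 r
  | succ q ih =>
    rw [chainLaw_succ, bind_apply_ne_zero_iff]
    refine ⟨(q + 1, r + 2), ih (by omega) (r + 1), ?_⟩
    rw [blockStep, min_eq_left (by omega), pure_apply_ne_zero_iff]

/-- One block leads from any state to the empty queue or to a state with `1 ≤ q ≤ K` and `1 ≤ r`, and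
the empty queue reaches all of these in exactly `K` blocks, since it can stay empty. For `K = 0` the
queue is empty after two blocks. -/
theorem meetLim_blockStep_eq_one {θ : ℝ≥0} (h0 : 0 < θ) (h1 : θ < 1) (K : ℕ) (x y : State) :
    meetLim (blockStep θ K) (0, 0) x y = 1 := by
  rcases K with _ | K
  · have hz : ∀ x y : State, blockStep θ 0 x y ≠ 0 → y.1 = 0 := by
      rintro ⟨_ | q, _ | _ | r⟩ y h <;>
        · simp [blockStep, startService, Prod.ext_iff] at h
          exact h.1
    have hz' : ∀ x y : State, x.1 = 0 → blockStep θ 0 x y ≠ 0 → y = (0, 0) := by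
      rintro ⟨q, r⟩ y hx h
      obtain rfl : q = 0 := hx
      simpa [blockStep, startService] using h
    refine meetLim_eq_one_of_step _ _ fun x' y' hx hy => ?_
    refine meetLim_eq_one_of_step _ _ fun x'' y'' hx' hy' => ?_
    rw [hz' _ _ (hz _ _ hx) hx', hz' _ _ (hz _ _ hy) hy', meetLim_self]
  · have hreach : ∀ z : State, (z = (0, 0) ∨ (1 ≤ z.1 ∧ z.1 ≤ K + 1 ∧ 1 ≤ z.2)) →
        chainLaw (blockStep θ (K + 1)) (K + 1) (PMF.pure (0, 0)) z ≠ 0 := by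
      rintro ⟨q, r⟩ (h | ⟨hq1, hq2, hr⟩)
      · rw [h]
        exact chainLaw_blockStep_zero_ne_zero h0 _ _
      · obtain ⟨q, rfl⟩ := Nat.exists_eq_add_of_le' hq1
        obtain ⟨r, rfl⟩ := Nat.exists_eq_add_of_le' hr
        have hq : q ≤ K := Nat.succ_le_succ_iff.mp hq2
        have := chainLaw_blockStep_ne_zero h0 hq (K - q) r
        rwa [Nat.sub_add_cancel hq] at this
    exact meetLim_eq_one_of_step _ _ fun x' y' hx hy =>
      meetLim_eq_one_of_reach (queueLaw_bind_blockStep h0 h1 (K + 1))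
        (queueLaw_zero_ne_zero h0 h1 (K + 1)) (K + 1)
        (hreach x' (of_blockStep_apply_ne_zero hx)) (hreach y' (of_blockStep_apply_ne_zero hy))

/-! ### The stationary queue-length distribution -/

lemma queueProb_queueLaw_of_lt {θ : ℝ≥0} (h0 : 0 < θ) (h1 : θ < 1) {K j : ℕ} (hj : j < K) :
    queueProb (queueLaw h0 h1 K) j =
      (varphi θ ((j : ℤ) - 1) - varphi θ (j : ℤ)) / (1 - (θ : ℝ) * varphi θ (K : ℤ)) := by
  have h0' : (0 : ℝ) < θ := by exact_mod_cast h0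
  have h1' : (θ : ℝ) < 1 := by exact_mod_cast h1
  obtain ⟨K, rfl⟩ : ∃ m, K = m + 1 := ⟨K - 1, by omega⟩
  have hF := queueCdf_pos_and_le_succ h0' h1'
  rw [queueProb_eq, expect_queueLaw, ← cycleLength_succ h0' h1', ENNReal.toReal_mul,
    ENNReal.toReal_inv, ENNReal.toReal_ofReal (cycleLength_pos h0' h1' _).le,
    ← div_eq_inv_mul]
  congr 1
  rcases j with _ | j
  · rw [lintegral_occupation_length_zero, ENNReal.toReal_ofReal (hF 0).1.le]
    rfl
  · rw [lintegral_occupation_length_succ h0 h1 hj,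
      ENNReal.toReal_ofReal (sub_nonneg.mpr (hF j).2), show ((j + 1 : ℕ) : ℤ) - 1 = (j : ℕ) by
        push_cast; ring, queueCdf, queueCdf]
    ring

lemma queueProb_queueLaw_self {θ : ℝ≥0} (h0 : 0 < θ) (h1 : θ < 1) (K : ℕ) :
    queueProb (queueLaw h0 h1 K) K =
      (varphi θ ((K : ℤ) - 1) - (θ : ℝ) * varphi θ (K : ℤ)) /
        (1 - (θ : ℝ) * varphi θ (K : ℤ)) := by
  have h0' : (0 : ℝ) < θ := by exact_mod_cast h0
  have h1' : (θ : ℝ) < 1 := by exact_mod_cast h1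
  have hZ : 1 - (θ : ℝ) * varphi θ (K : ℤ) ≠ 0 := by
    have := (queueCdf_pos_and_le_succ h0' h1' K).1
    rw [varphi_eq]
    nlinarith
  have hsum := sum_queueProb_queueLaw h0 h1 K
  rw [Finset.sum_range_succ, Finset.sum_congr rfl fun j hj =>
    queueProb_queueLaw_of_lt h0 h1 (Finset.mem_range.mp hj), ← Finset.sum_div] at hsum
  have htel := Finset.sum_range_sub' (fun j : ℕ => varphi θ ((j : ℤ) - 1)) K
  simp only [Nat.cast_add, Nat.cast_one, add_sub_cancel_right] at htel
  have hneg : varphi θ (((0 : ℕ) : ℤ) - 1) = 1 := rfl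
  rw [htel, hneg] at hsum
  field_simp at hsum ⊢
  linarith

end FadingQueue

end

theorem mainTheorem2 (θ : ℝ≥0) (hθ_pos : 0 < θ) (hθ_lt : θ < 1) (K : ℕ) :
    (∀ k : ℕ, Summable (FadingQueue.varphiTerm θ k)) ∧
    ∃ μ : PMF FadingQueue.State,
      FadingQueue.IsStationary θ K μ ∧
      (∀ ν : PMF FadingQueue.State, FadingQueue.IsStationary θ K ν → ν = μ) ∧
      (∀ (x : FadingQueue.State) (j : ℕ),
        Tendsto (fun n : ℕ => FadingQueue.queueProb (FadingQueue.stateLaw θ K x n) j)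
          atTop (𝓝 (FadingQueue.queueProb μ j))) ∧
      (∀ j : ℕ, j < K →
        FadingQueue.queueProb μ j =
          (FadingQueue.varphi θ ((j : ℤ) - 1) - FadingQueue.varphi θ (j : ℤ)) /
            (1 - (θ : ℝ) * FadingQueue.varphi θ (K : ℤ))) ∧
      FadingQueue.queueProb μ K =
        (FadingQueue.varphi θ ((K : ℤ) - 1) - (θ : ℝ) * FadingQueue.varphi θ (K : ℤ)) /
          (1 - (θ : ℝ) * FadingQueue.varphi θ (K : ℤ)) := by
  have hμ := FadingQueue.queueLaw_bind_blockStep hθ_pos hθ_lt K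
  have hmeet := FadingQueue.meetLim_blockStep_eq_one hθ_pos hθ_lt K
  refine ⟨FadingQueue.summable_varphiTerm (by exact_mod_cast hθ_pos) (by exact_mod_cast hθ_lt),
    FadingQueue.queueLaw hθ_pos hθ_lt K, hμ,
    fun ν hν => FadingQueue.eq_of_stationary hμ hν hmeet, fun x j => ?_,
    fun j hj => FadingQueue.queueProb_queueLaw_of_lt hθ_pos hθ_lt hj,
    FadingQueue.queueProb_queueLaw_self hθ_pos hθ_lt K⟩
  have hf : ∀ z : FadingQueue.State, (if z.1 = j then (1 : ℝ≥0∞) else 0) ≤ 1 := fun z => by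
    split_ifs <;> simp
  simp only [FadingQueue.queueProb_eq]
  exact (ENNReal.tendsto_toReal
    ((FadingQueue.expect_le_one _ hf).trans_lt ENNReal.one_lt_top).ne).comp
    (FadingQueue.tendsto_expect_chainLaw hμ hmeet x hf)
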